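/- Let $m\ge 1$ be a fixed integer and let $G_m^n$ be the Bollobás–Riordan preferential attachment multigraph, defined as follows. $G_1^1$ has a single vertex $1$ with one loop; given $G_1^{t-1}$, a new vertex $t$ is added together with one edge, which joins $t$ to a vertex $s\in\{1,\dots,t-1\}$ with probability $d(s)/(2t-1)$, where $d(s)$ is the degree of $s$ in $G_1^{t-1}$ (a loop contributes $2$), and which is a loop at $t$ with probability $1/(2t-1)$. The multigraph $G_m^n$ on the vertex set $\{1,\dots,n\}$ is obtained from $G_1^{mn}$ by merging, for each $j\in\{1,\dots,n\}$, the vertices $m(j-1)+1,\dots,mj$ into the vertex $j$, keeping all $mn$ edges. Let $\mathcal P_n$ be the total number of (unordered) pairs of parallel edges in $G_m^n$, that is, of pairs of distinct edges that join the same two distinct vertices. Then: (1) With high probability $\mathcal P_n$ is asymptotic to $\frac{m^2-1}{16}\log^2 n$: for every $\varepsilon>0$, $$\mathbb P\Bigl(\bigl|\mathcal P_n-\tfrac{m^2-1}{16}\log^2 n\bigr|\le \varepsilon\,\tfrac{m^2-1}{16}\log^2 n\Bigr)\to 1\qquad(n\to\infty).$$ (2) Consequently, if $m\ge 2$, then with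 high probability the identification of parallel edges (replacing each class of mutually parallel edges by a single edge) reduces the number of edges by $\Theta(\log^2 n)$: there are constants $0<c\le C$, depending only on $m$, such that with probability tending to $1$ as $n\to\infty$ the number of edges drops by at least $c\log^2 n$ and at most $C\log^2 n$. -/

import Mathlib

open Filter Topology
open scoped ENNReal

namespace PrefAttach

/-! ### Multigraphs: degrees, parallel edges, identification of parallel edges -/

/-- The degree of a vertex of a (finite) multigraph; a loop contributes `2`. -/
noncomputable def degree {α β : Type*} (G : Graph α β) (x : α) : ℕ :=
  {e | G.IsNonloopAt e x}.ncard + 2 * {e | G.IsLoopAt e x}.ncard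

/-- Two edges are parallel if they are different and join the same two distinct vertices
(so loops are never parallel). -/
def Parallel {α β : Type*} (G : Graph α β) (e f : β) : Prop :=
  e ≠ f ∧ ∃ x y, x ≠ y ∧ G.IsLink e x y ∧ G.IsLink f x y

/-- The number of unordered pairs `{e, f}` of parallel edges
(each is listed once, with the smaller label first). -/
noncomputable def numParallelPairs {α β : Type*} [LinearOrder β] (G : Graph α β) : ℕ :=
  {p : β × β | p.1 < p.2 ∧ Parallel G p.1 p.2}.ncard

/-- All edges that are identified with `e` when parallel edges are identified. -/
def parallelClass {α β : Type*} (G : Graph α β) (e : β) : Set β :=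
  {f | f = e ∨ Parallel G e f}

/-- By how much the number of edges drops when every class of mutually parallel edges
is replaced by a single edge. -/
noncomputable def identificationReduction {α β : Type*} (G : Graph α β) : ℝ :=
  (G.edgeSet.ncard : ℝ) - ((parallelClass G '' G.edgeSet).ncard : ℝ)

/-! ### The preferential attachment process for `m = 1`

Vertices and edges are labelled `0, …, t - 1` instead of `1, …, t`. Every vertex `i` sends out
exactly one edge, the edge with label `i`; its other end is called the target of `i`.
So the graph at time `t` is recorded by the map `c : Fin t → Fin t` of targets. -/

/-- The multigraph on the vertices `0, …, t - 1` in which edge `i` joins `i` to `c i`. -/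
def targetGraph {t : ℕ} (c : Fin t → Fin t) : Graph (Fin t) (Fin t) where
  vertexSet := Set.univ
  IsLink e x y := s(x, y) = s(e, c e)
  edgeSet := Set.univ
  isLink_symm e _ := ⟨fun x y h => Sym2.eq_swap.trans h⟩
  eq_or_eq_of_isLink_of_isLink e x y v w h h' := by
    have h2 := h.trans h'.symm
    rw [Sym2.eq_iff] at h2
    tauto
  edge_mem_iff_exists_isLink e := ⟨fun _ => ⟨e, c e, rfl⟩, fun _ => Set.mem_univ _⟩
  left_mem_of_isLink _ _ _ _ := Set.mem_univ _

/-- The weights with which the new vertex `t` chooses its target: an old vertex has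
its current degree as weight, and the new vertex itself (a loop) has weight `1`. -/
noncomputable def targetWeight {t : ℕ} (c : Fin t → Fin t) : Fin (t + 1) → ℝ≥0∞ :=
  Fin.snoc (α := fun _ => ℝ≥0∞) (fun s => (degree (targetGraph c) s : ℝ≥0∞)) 1

theorem tsum_targetWeight_ne_zero {t : ℕ} (c : Fin t → Fin t) :
    ∑' s, targetWeight c s ≠ 0 := by
  intro h
  have h1 := ENNReal.tsum_eq_zero.mp h (Fin.last t)
  simp [targetWeight] at h1

theorem tsum_targetWeight_ne_top {t : ℕ} (c : Fin t → Fin t) :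
    ∑' s, targetWeight c s ≠ ∞ := by
  rw [tsum_fintype, Fin.sum_univ_castSucc]
  simp [targetWeight]

/-- The distribution of the target of the new vertex `t`, given the graph at time `t`:
the probabilities are proportional to the weights. -/
noncomputable def newTarget {t : ℕ} (c : Fin t → Fin t) : PMF (Fin (t + 1)) :=
  PMF.normalize (targetWeight c) (tsum_targetWeight_ne_zero c) (tsum_targetWeight_ne_top c)

/-- The distribution of the map of targets at time `t`. -/
noncomputable def targets : (t : ℕ) → PMF (Fin t → Fin t)
  | 0 => PMF.pure Fin.elim0
  | t + 1 => (targets t).bind fun c => (newTarget c).map fun s =>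
      Fin.snoc (α := fun _ => Fin (t + 1)) (fun i => (c i).castSucc) s

/-- The random multigraph `G_1^t`. -/
noncomputable def G₁ (t : ℕ) : PMF (Graph (Fin t) (Fin t)) :=
  (targets t).map targetGraph

/-- The random multigraph `G_m^n`: take `G_1^{mn}` and merge each block of `m` consecutive
vertices, `{m j, …, m j + m - 1}`, into the single vertex `j`. All `m n` edges are kept. -/
noncomputable def Gₘ (m n : ℕ) : PMF (Graph (Fin n) (Fin (n * m))) :=
  (G₁ (n * m)).map (Graph.map Fin.divNat)

/-! ### With high probability -/

/-- The events `A n`, about a random object with law `X n`, hold with high probability: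
their probabilities tend to `1`. -/
def Whp {Ω : ℕ → Type*} (X : ∀ n, PMF (Ω n)) (A : ∀ n, Set (Ω n)) : Prop :=
  Tendsto (fun n => (X n).toOuterMeasure (A n)) atTop (𝓝 1)

end PrefAttach

namespace PrefAttach

/-! ### Histories of target blocks and the stub multiset

A history is a map `ω : ℕ → ℕ`, where `ω a` is the block that contains the target of the edge `a`.
The new edge `t` picks its target block uniformly among the `2 t + 1` stubs present. -/

/-! Only blocks of targets matter: edge `t` picks one of the `2t + 1` stubs (edge ends) present
uniformly, and `ω t` records the block of that stub. As edges point backwards, two edges are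
parallel after merging iff they leave the same block and share a target block other than their own.
So the number of parallel pairs is `∑ t, newPairs m t`, and this sum is compared with its mean
through successive compensators in L¹.

Given the past, `t` repeats the target of an earlier edge `a` of its block with probability `d / (2t
+ 1)`, where `d` is the degree of the block `ω a`. Up to `O(1/a)` this is `targetShare m a`, the
same ratio taken at time `a`. Each `a` serves `m - 1 - a % m` later edges, on average `(m - 1) / 2`.
The conditional mean of the share is `W_a / (2a + 1)`, where `W_a = ∑ d² / (2a + 1)` is
`meanWeight`. The mean growth of `∑ d²` caused by the targets is exactly cancelled by the growth of
the denominator, so `W` is a martingale plus a deterministic drift and a small contribution of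
loops. Hence `W_a ≈ (m + 1) H_a`, with `H_a = ∑_{b < a} 1 / (2b + 1) ≈ log a / 2`. The total is
about `(m² - 1) / 2 · ∑ H_a / (2a + 1) ≈ (m² - 1) / 4 · H² ≈ (m² - 1) / 16 · log² n`.

Martingale errors are controlled by orthogonality (`histMean_abs_sum_sub_stubMean_le`). A
third-moment bound on degrees keeps `W` within `O(√log)` of its centre in mean; the sum then has
error `O(log^{3/2})`, and Markov's inequality gives (1). For (2), an edge is lost iff it is the
larger edge of some parallel pair, and it is the larger edge of at most `m` pairs. -/

/-- The blocks of the stubs among which the edge `t` chooses its target. -/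
def stubs (m : ℕ) (ω : ℕ → ℕ) : ℕ → Multiset ℕ
  | 0 => {0}
  | t + 1 => ((t + 1) / m) ::ₘ ω t ::ₘ stubs m ω t

/-- A history is valid if every edge points to its own block or an earlier one. -/
def Valid (m : ℕ) (ω : ℕ → ℕ) : Prop := ∀ a, ω a ≤ a / m

theorem card_stubs (m : ℕ) (ω : ℕ → ℕ) (t : ℕ) : (stubs m ω t).card = 2 * t + 1 := by
  induction t with
  | zero => rfl
  | succ t ih => simp [stubs, ih]; ring

theorem stubs_congr {m : ℕ} {ω ω' : ℕ → ℕ} {t : ℕ} (h : ∀ a < t, ω a = ω' a) :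
    stubs m ω t = stubs m ω' t := by
  induction t with
  | zero => rfl
  | succ t ih =>
    simp only [stubs]
    rw [ih fun a ha => h a (by omega), h t (by omega)]

theorem stubs_update {m : ℕ} (ω : ℕ → ℕ) {s t : ℕ} (h : s ≤ t) (i : ℕ) :
    stubs m (Function.update ω t i) s = stubs m ω s :=
  stubs_congr fun a ha => by rw [Function.update_of_ne (by omega)]

theorem Valid.le_of_mem_stubs {m : ℕ} {ω : ℕ → ℕ} (h : Valid m ω) {t i : ℕ}
    (hi : i ∈ stubs m ω t) : i ≤ t / m := by
  induction t with
  | zero => simp_all [stubs]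
  | succ t ih =>
    have h1 : t / m ≤ (t + 1) / m := Nat.div_le_div_right (by omega)
    simp only [stubs, Multiset.mem_cons] at hi
    rcases hi with rfl | rfl | hi
    · rfl
    · exact (h t).trans h1
    · exact (ih hi).trans h1

theorem Valid.update {m : ℕ} {ω : ℕ → ℕ} (h : Valid m ω) {t i : ℕ} (hi : i ≤ t / m) :
    Valid m (Function.update ω t i) := by
  intro a
  by_cases ha : a = t
  · subst ha; simpa using hi
  · rw [Function.update_of_ne ha]; exact h a

theorem valid_zero (m : ℕ) : Valid m 0 := fun _ => Nat.zero_le _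

/-! ### Conditional and total expectation over histories -/

/-- Conditional expectation over the target block of the edge `t`. -/
noncomputable def stubMean (m t : ℕ) : ((ℕ → ℕ) → ℝ) →ₗ[ℝ] ((ℕ → ℕ) → ℝ) where
  toFun F ω := ((stubs m ω t).map fun i => F (Function.update ω t i)).sum / (2 * t + 1)
  map_add' F G := by
    ext ω
    simp [Multiset.sum_map_add, add_div]
  map_smul' r F := by
    ext ω
    simp [Multiset.sum_map_mul_left, mul_div_assoc]

/-- Expectation over the target blocks of the edges before `t`. -/
noncomputable def histMean (m : ℕ) : ℕ → (((ℕ → ℕ) → ℝ) →ₗ[ℝ] ℝ)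
  | 0 => LinearMap.proj 0
  | t + 1 => histMean m t ∘ₗ stubMean m t

section
variable {m : ℕ}

theorem stubMean_apply (t : ℕ) (F : (ℕ → ℕ) → ℝ) (ω : ℕ → ℕ) : stubMean m t F ω =
    ((stubs m ω t).map fun i => F (Function.update ω t i)).sum / (2 * t + 1) := rfl

theorem histMean_succ (t : ℕ) (F : (ℕ → ℕ) → ℝ) :
    histMean m (t + 1) F = histMean m t (stubMean m t F) := rfl

theorem stubMean_mul_of_dependsOn {t : ℕ} {X : (ℕ → ℕ) → ℝ} (hX : DependsOn X (Set.Iio t))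
    (F : (ℕ → ℕ) → ℝ) : stubMean m t (X * F) = X * stubMean m t F := by
  ext ω
  have : ∀ i, X (Function.update ω t i) = X ω := fun i =>
    hX fun a ha => Function.update_of_ne (ne_of_lt ha) _ _
  simp only [stubMean_apply, Pi.mul_apply, this, Multiset.sum_map_mul_left, mul_div_assoc]

theorem stubMean_one (t : ℕ) : stubMean m t 1 = 1 := by
  ext ω
  simp only [stubMean_apply, Pi.one_apply, Multiset.map_const', Multiset.sum_replicate, card_stubs]
  have : (2 * t + 1 : ℝ) ≠ 0 := by positivity
  simp [this]

theorem stubMean_of_dependsOn {t : ℕ} {X : (ℕ → ℕ) → ℝ} (hX : DependsOn X (Set.Iio t)) :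
    stubMean m t X = X := by
  have := stubMean_mul_of_dependsOn (m := m) hX 1
  rwa [stubMean_one, mul_one] at this

/-- Stubs at time `t` lie in blocks up to `t / m`, so a random step keeps a valid history valid;
pointwise bounds are needed on valid histories only. -/
theorem stubMean_mono {t : ℕ} {F G : (ℕ → ℕ) → ℝ} (h : ∀ ω, Valid m ω → F ω ≤ G ω)
    {ω : ℕ → ℕ} (hω : Valid m ω) : stubMean m t F ω ≤ stubMean m t G ω := by
  rw [stubMean_apply, stubMean_apply]
  gcongr
  exact Multiset.sum_map_le_sum_map _ _ fun i hi => h _ (hω.update (hω.le_of_mem_stubs hi))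

theorem histMean_mono {t : ℕ} {F G : (ℕ → ℕ) → ℝ} (h : ∀ ω, Valid m ω → F ω ≤ G ω) :
    histMean m t F ≤ histMean m t G := by
  induction t generalizing F G with
  | zero => exact h 0 (valid_zero m)
  | succ t ih => exact ih fun ω hω => stubMean_mono h hω

theorem histMean_one (t : ℕ) : histMean m t 1 = 1 := by
  induction t with
  | zero => rfl
  | succ t ih => rw [histMean_succ, stubMean_one, ih]

theorem histMean_const (t : ℕ) (c : ℝ) : histMean m t (fun _ => c) = c := by
  have : (fun _ : ℕ → ℕ => c) = c • (1 : (ℕ → ℕ) → ℝ) := by ext; simp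
  rw [this, map_smul, histMean_one]; simp

theorem histMean_nonneg {t : ℕ} {F : (ℕ → ℕ) → ℝ} (h : ∀ ω, Valid m ω → 0 ≤ F ω) :
    0 ≤ histMean m t F := by
  simpa using histMean_mono (m := m) (t := t) (F := 0) h

theorem histMean_add (t : ℕ) (F G : (ℕ → ℕ) → ℝ) :
    histMean m t (fun ω => F ω + G ω) = histMean m t F + histMean m t G :=
  map_add (histMean m t) F G

theorem histMean_sub (t : ℕ) (F G : (ℕ → ℕ) → ℝ) :
    histMean m t (fun ω => F ω - G ω) = histMean m t F - histMean m t G :=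
  map_sub (histMean m t) F G

theorem histMean_mul_left (t : ℕ) (c : ℝ) (F : (ℕ → ℕ) → ℝ) :
    histMean m t (fun ω => c * F ω) = c * histMean m t F :=
  map_smul (histMean m t) c F

theorem histMean_sum {ι : Type*} (t : ℕ) (s : Finset ι) (F : ι → (ℕ → ℕ) → ℝ) :
    histMean m t (fun ω => ∑ i ∈ s, F i ω) = ∑ i ∈ s, histMean m t (F i) := by
  rw [← map_sum]; congr 1; ext ω; simp

theorem histMean_of_dependsOn {s t : ℕ} (hst : s ≤ t) {X : (ℕ → ℕ) → ℝ}
    (hX : DependsOn X (Set.Iio s)) : histMean m t X = histMean m s X := by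
  induction t, hst using Nat.le_induction with
  | base => rfl
  | succ t hst ih =>
    rw [histMean_succ, stubMean_of_dependsOn (hX.mono (Set.Iio_subset_Iio hst)), ih]

theorem dependsOn_stubMean {t : ℕ} {F : (ℕ → ℕ) → ℝ} (hF : DependsOn F (Set.Iio (t + 1))) :
    DependsOn (stubMean m t F) (Set.Iio t) := by
  intro ω ω' h
  rw [stubMean_apply, stubMean_apply, stubs_congr (ω' := ω') fun a ha => h a ha]
  congr 3
  ext i
  refine hF fun a ha => ?_
  by_cases hat : a = t
  · subst hat; simp
  · rw [Function.update_of_ne hat, Function.update_of_ne hat]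
    exact h a (lt_of_le_of_ne (Nat.lt_succ_iff.mp ha) hat)

/-- The variance of `|F|` is nonnegative. -/
theorem abs_histMean_le_sqrt (t : ℕ) (F : (ℕ → ℕ) → ℝ) :
    histMean m t (fun ω => |F ω|) ≤ √(histMean m t fun ω => F ω ^ 2) := by
  set c := histMean m t (fun ω => |F ω|) with hc
  have h0 : 0 ≤ histMean m t fun ω => (|F ω| - c) ^ 2 := histMean_nonneg fun _ _ => sq_nonneg _
  have h1 : (fun ω => (|F ω| - c) ^ 2) = fun ω => (F ω ^ 2 - 2 * c * |F ω|) + c ^ 2 := by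
    ext ω; rw [sub_sq, sq_abs]; ring
  rw [h1, histMean_add, histMean_sub, histMean_mul_left, histMean_const, ← hc] at h0
  exact Real.le_sqrt_of_sq_le (by linarith)

/-! ### Sums of martingale differences -/

theorem dependsOn_sum {ι : Type*} {s : Finset ι} {S : Set ℕ} {F : ι → (ℕ → ℕ) → ℝ}
    (h : ∀ i ∈ s, DependsOn (F i) S) : DependsOn (fun ω => ∑ i ∈ s, F i ω) S :=
  fun _ _ hω => Finset.sum_congr rfl fun i hi => h i hi hω

/-- Martingale differences are orthogonal: the cross term of `d T` with the earlier sum vanishes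
after conditioning on the edges before `T`. -/
theorem histMean_sq_sum {d : ℕ → (ℕ → ℕ) → ℝ} (hd : ∀ t, DependsOn (d t) (Set.Iio (t + 1)))
    (h0 : ∀ t, stubMean m t (d t) = 0) (T : ℕ) :
    histMean m T (fun ω => (∑ t ∈ Finset.range T, d t ω) ^ 2) =
      ∑ t ∈ Finset.range T, histMean m (t + 1) fun ω => d t ω ^ 2 := by
  induction T with
  | zero => simpa using histMean_const (m := m) 0 0
  | succ T ih =>
    have hS : DependsOn (fun ω => ∑ t ∈ Finset.range T, d t ω) (Set.Iio T) :=
      dependsOn_sum fun t ht => (hd t).mono (Set.Iio_subset_Iio (Finset.mem_range.mp ht))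
    have hS2 : DependsOn (fun ω => (∑ t ∈ Finset.range T, d t ω) ^ 2) (Set.Iio T) :=
      fun ω ω' h => congrArg (· ^ 2) (hS h)
    have e : (fun ω => (∑ t ∈ Finset.range (T + 1), d t ω) ^ 2) = fun ω =>
        ((∑ t ∈ Finset.range T, d t ω) ^ 2 + 2 * ((∑ t ∈ Finset.range T, d t ω) * d T ω))
          + d T ω ^ 2 := by
      ext ω; rw [Finset.sum_range_succ]; ring
    have hz : histMean m (T + 1) (fun ω => (∑ t ∈ Finset.range T, d t ω) * d T ω) = 0 := by
      rw [histMean_succ]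
      have := stubMean_mul_of_dependsOn (m := m) hS (d T)
      rw [h0, mul_zero] at this
      erw [this, map_zero]
    rw [e, histMean_add, histMean_add, histMean_mul_left, hz,
      histMean_of_dependsOn (Nat.le_succ T) hS2, ih, Finset.sum_range_succ]
    ring

/-- With `c` the conditional mean, `E (x - c)² = E x² - E c²`. -/
theorem histMean_sq_sub_stubMean_le {t : ℕ} {x : (ℕ → ℕ) → ℝ}
    (hx : DependsOn x (Set.Iio (t + 1))) :
    histMean m (t + 1) (fun ω => (x ω - stubMean m t x ω) ^ 2) ≤
      histMean m (t + 1) fun ω => x ω ^ 2 := by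
  set c := stubMean m t x with hc
  have hcd : DependsOn c (Set.Iio t) := dependsOn_stubMean hx
  have h1 : histMean m (t + 1) (fun ω => c ω * x ω) = histMean m t fun ω => c ω ^ 2 := by
    rw [histMean_succ]
    have := stubMean_mul_of_dependsOn (m := m) hcd x
    rw [← hc] at this
    erw [this]
    congr 1; ext ω; simp [sq]
  have h2 : histMean m (t + 1) (fun ω => c ω ^ 2) = histMean m t fun ω => c ω ^ 2 :=
    histMean_of_dependsOn (Nat.le_succ t) fun ω ω' h => congrArg (· ^ 2) (hcd h)
  have e : (fun ω => (x ω - c ω) ^ 2) = fun ω => (x ω ^ 2 - 2 * (c ω * x ω)) + c ω ^ 2 := by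
    ext ω; ring
  rw [e, histMean_add, histMean_sub, histMean_mul_left, h1, h2]
  have : 0 ≤ histMean m t fun ω => c ω ^ 2 := histMean_nonneg fun _ _ => sq_nonneg _
  linarith

theorem histMean_abs_sum_sub_stubMean_le {x : ℕ → (ℕ → ℕ) → ℝ}
    (hx : ∀ t, DependsOn (x t) (Set.Iio (t + 1))) (T : ℕ) :
    histMean m T (fun ω => |∑ t ∈ Finset.range T, (x t ω - stubMean m t (x t) ω)|) ≤
      √(∑ t ∈ Finset.range T, histMean m (t + 1) fun ω => x t ω ^ 2) := by
  refine (abs_histMean_le_sqrt _ _).trans (Real.sqrt_le_sqrt ?_)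
  have hs : ∀ t, DependsOn (stubMean m t (x t)) (Set.Iio t) := fun t => dependsOn_stubMean (hx t)
  rw [histMean_sq_sum (d := fun t ω => x t ω - stubMean m t (x t) ω)]
  · exact Finset.sum_le_sum fun t _ => histMean_sq_sub_stubMean_le (hx t)
  · intro t ω ω' h
    have := (hs t).mono (Set.Iio_subset_Iio (Nat.le_succ t)) h
    simp only [hx t h, this]
  · intro t
    have : (fun ω => x t ω - stubMean m t (x t) ω) = x t - stubMean m t (x t) := rfl
    rw [this, map_sub, stubMean_of_dependsOn (hs t), sub_self]

end

/-! ### Power sums of multiplicities -/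

/-- The sum of `φ (count i S)` over the elements `i` of `S`. -/
def sumCount (φ : ℕ → ℝ) (S : Multiset ℕ) : ℝ := (S.map fun i => φ (S.count i)).sum

theorem sum_map_ite_eq (S : Multiset ℕ) (i : ℕ) (c : ℝ) :
    (S.map fun j => if j = i then c else 0).sum = S.count i * c := by
  induction S using Multiset.induction with
  | empty => simp
  | cons a S ih =>
    rw [Multiset.map_cons, Multiset.sum_cons, ih, Multiset.count_cons]
    by_cases h : a = i
    · simp [h]; ring
    · simp [h, Ne.symm h]

/-- Grouped by distinct elements, the sum is `∑ k φ(k)` over the multiplicities `k`, and only the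
multiplicity of `i` changes. -/
theorem sumCount_cons (φ : ℕ → ℝ) (i : ℕ) (S : Multiset ℕ) :
    sumCount φ (i ::ₘ S) = sumCount φ S +
      ((S.count i + 1) * φ (S.count i + 1) - S.count i * φ (S.count i)) := by
  have h : ∀ j, φ ((i ::ₘ S).count j) = φ (S.count j) +
      if j = i then φ (S.count i + 1) - φ (S.count i) else 0 := by
    intro j
    rw [Multiset.count_cons]
    by_cases hj : j = i
    · subst hj; simp
    · simp [hj]
  unfold sumCount
  rw [Multiset.map_cons, Multiset.sum_cons]
  simp only [h, Multiset.sum_map_add, sum_map_ite_eq]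
  simp; ring

section
variable {m : ℕ}

/-- Choosing a uniform stub size-biases the block, which is exactly the weighting in `sumCount`. -/
theorem stubMean_count (φ : ℕ → ℝ) (t : ℕ) (ω : ℕ → ℕ) :
    stubMean m t (fun ω => φ ((stubs m ω t).count (ω t))) ω =
      sumCount φ (stubs m ω t) / (2 * t + 1) := by
  rw [stubMean_apply]
  simp only [stubs_update ω le_rfl, Function.update_self, sumCount]

theorem stubMean_ite_eq (t i : ℕ) (ω : ℕ → ℕ) :
    stubMean m t (fun ω => if ω t = i then 1 else 0) ω =
      (stubs m ω t).count i / (2 * t + 1) := by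
  rw [stubMean_apply]
  simp only [Function.update_self, sum_map_ite_eq, mul_one]

/-! ### Degrees of blocks -/

theorem count_stubs_succ (ω : ℕ → ℕ) (t i : ℕ) : (stubs m ω (t + 1)).count i =
    (stubs m ω t).count i + (if i = ω t then 1 else 0) + if i = (t + 1) / m then 1 else 0 := by
  simp only [stubs, Multiset.count_cons]

theorem count_stubs_mono (ω : ℕ → ℕ) (i : ℕ) : Monotone fun t => (stubs m ω t).count i :=
  monotone_nat_of_le_succ fun t => by rw [count_stubs_succ]; omega

theorem count_stubs_add_le (ω : ℕ → ℕ) (i s k : ℕ) :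
    (stubs m ω (s + k)).count i ≤ (stubs m ω s).count i + 2 * k := by
  induction k with
  | zero => simp
  | succ k ih =>
    rw [← add_assoc, count_stubs_succ]
    split_ifs <;> omega

theorem count_stubs_le (ω : ℕ → ℕ) (t i : ℕ) : (stubs m ω t).count i ≤ 2 * t + 1 :=
  (Multiset.count_le_card _ _).trans_eq (card_stubs m ω t)

theorem count_stubs_eq (ω : ℕ → ℕ) (t i : ℕ) : (stubs m ω t).count i =
    ((Finset.range (t + 1)).filter fun a => a / m = i).card +
      ((Finset.range t).filter fun a => ω a = i).card := by
  induction t with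
  | zero =>
    rw [Finset.range_one, Finset.filter_singleton, Nat.zero_div, Finset.range_zero,
      Finset.filter_empty, Finset.card_empty, add_zero, stubs, Multiset.count_singleton]
    simp only [eq_comm (a := i)]
    split_ifs <;> rfl
  | succ t ih =>
    rw [count_stubs_succ, ih, Finset.range_add_one (n := t + 1), Finset.filter_insert,
      Finset.range_add_one (n := t), Finset.filter_insert (p := fun a => ω a = i)]
    simp only [eq_comm (a := i)]
    split_ifs <;> simp [Finset.card_insert_of_notMem] <;> omega

theorem card_block_le (hm : 1 ≤ m) (N i : ℕ) :
    ((Finset.range N).filter fun a => a / m = i).card ≤ m := by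
  have : ((Finset.range N).filter fun a => a / m = i) ⊆ Finset.Ico (i * m) (i * m + m) := by
    intro a ha
    obtain ⟨-, h⟩ := Finset.mem_filter.mp ha
    rw [Nat.div_eq_iff (by omega)] at h
    exact Finset.mem_Ico.mpr (by omega)
  simpa using Finset.card_le_card this

theorem card_block_init (t : ℕ) :
    ((Finset.range t).filter fun a => a / m = t / m).card = t % m := by
  rcases Nat.eq_zero_or_pos m with rfl | hm
  · simp
  have : ((Finset.range t).filter fun a => a / m = t / m) = Finset.Ico (t / m * m) t := by
    ext a
    simp only [Finset.mem_filter, Finset.mem_range, Finset.mem_Ico]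
    refine and_comm.trans (and_congr_left fun ha => ⟨fun h => ?_, fun h => ?_⟩)
    · rw [← h]; exact Nat.div_mul_le_self a m
    · exact le_antisymm (Nat.div_le_div_right ha.le) ((Nat.le_div_iff_mul_le hm).mpr h)
  rw [this, Nat.card_Ico]
  have := Nat.div_add_mod' t m
  omega

/-- An edge before `t` that points into the block of `t` must itself lie in that block, so there are
at most `m` own stubs and at most `m` target stubs. -/
theorem Valid.count_own_le (hm : 1 ≤ m) {ω : ℕ → ℕ} (h : Valid m ω) (t : ℕ) :
    (stubs m ω t).count (t / m) ≤ 2 * m := by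
  rw [count_stubs_eq]
  have h1 := card_block_le hm (t + 1) (t / m)
  have h2 : ((Finset.range t).filter fun a => ω a = t / m).card ≤
      ((Finset.range t).filter fun a => a / m = t / m).card := by
    refine Finset.card_le_card fun a ha => ?_
    simp only [Finset.mem_filter, Finset.mem_range] at ha ⊢
    exact ⟨ha.1, le_antisymm (Nat.div_le_div_right ha.1.le) (ha.2 ▸ h a)⟩
  have h3 := card_block_le hm t (t / m)
  omega

/-! ### The third moment -/

/-- The function `k ↦ (k + 1) (k + 2)`. -/
def risingSq (k : ℕ) : ℝ := (k + 1) * (k + 2)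

/-- The rising factorial `k(k+1)(k+2)` has difference `3(k+1)(k+2)`. So the third-moment sum grows
by a multiple of the summand that defines it, and its mean satisfies a closed recursion. -/
theorem sumCount_risingSq_cons (i : ℕ) (S : Multiset ℕ) :
    sumCount risingSq (i ::ₘ S) = sumCount risingSq S + 3 * risingSq (S.count i) := by
  rw [sumCount_cons]; simp only [risingSq]; push_cast; ring

theorem dependsOn_stubs {α : Type*} (f : Multiset ℕ → α) (t : ℕ) :
    DependsOn (fun ω => f (stubs m ω t)) (Set.Iio t) :=
  fun _ _ h => congrArg f (stubs_congr fun a ha => h a ha)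

/-- The recursion `E' ≤ E (1 + 3 / (2t + 1)) + C` has true order `t^{3/2}` plus lower terms; the
cruder `t²` is easy to induct on and loses only a logarithm later. -/
theorem histMean_risingSq_le (hm : 1 ≤ m) (t : ℕ) :
    histMean m t (fun ω => sumCount risingSq (stubs m ω t)) ≤
      (6 + 3 * risingSq (2 * m)) * (2 * t + 1) ^ 2 := by
  have hC : 0 ≤ 3 * risingSq (2 * m) := by unfold risingSq; positivity
  induction t with
  | zero =>
    have : (histMean m 0) (fun ω => sumCount risingSq (stubs m ω 0)) = 6 := by
      change sumCount risingSq {0} = 6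
      norm_num [sumCount, risingSq]
    rw [this]; simp; linarith
  | succ t ih =>
    set C := 3 * risingSq (2 * m) with hCdef
    set E := histMean m t (fun ω => sumCount risingSq (stubs m ω t))
    have h1 : histMean m (t + 1) (fun ω => sumCount risingSq (stubs m ω (t + 1))) ≤
        histMean m (t + 1) (fun ω => (sumCount risingSq (stubs m ω t) +
          3 * risingSq ((stubs m ω t).count (ω t))) + C) := by
      refine histMean_mono fun ω hω => ?_
      simp only [stubs]
      rw [sumCount_risingSq_cons, sumCount_risingSq_cons]
      gcongr
      have h2 := hω.count_own_le hm (t + 1)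
      simp only [stubs, Multiset.count_cons_self] at h2
      have h3 : (Multiset.count ((t + 1) / m) (ω t ::ₘ stubs m ω t) : ℝ) ≤ (2 * m : ℕ) := by
        exact_mod_cast (by omega)
      rw [hCdef]; unfold risingSq
      gcongr
    have h2 : histMean m (t + 1) (fun ω => risingSq ((stubs m ω t).count (ω t))) =
        (1 / (2 * t + 1)) * E := by
      rw [histMean_succ, ← histMean_mul_left]
      congr 1; ext ω
      rw [stubMean_count]; ring
    rw [histMean_add, histMean_add, histMean_const, histMean_mul_left, h2,
      histMean_of_dependsOn (Nat.le_succ t) (dependsOn_stubs _ t)] at h1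
    refine h1.trans ?_
    have h3 : 1 / (2 * t + 1 : ℝ) * E ≤ (6 + C) * (2 * t + 1) := by
      rw [one_div_mul_eq_div, div_le_iff₀ (by positivity)]
      linarith
    push_cast
    nlinarith

theorem histMean_count_sq_le (hm : 1 ≤ m) (t : ℕ) :
    histMean m (t + 1) (fun ω => ((stubs m ω t).count (ω t) : ℝ) ^ 2) ≤
      (6 + 3 * risingSq (2 * m)) * (2 * t + 1) := by
  have h1 : histMean m (t + 1) (fun ω => ((stubs m ω t).count (ω t) : ℝ) ^ 2) ≤
      histMean m (t + 1) (fun ω => risingSq ((stubs m ω t).count (ω t))) :=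
    histMean_mono fun ω _ => by
      unfold risingSq
      nlinarith [Nat.cast_nonneg (α := ℝ) ((stubs m ω t).count (ω t))]
  have h2 : histMean m (t + 1) (fun ω => risingSq ((stubs m ω t).count (ω t))) =
      (1 / (2 * t + 1)) * histMean m t (fun ω => sumCount risingSq (stubs m ω t)) := by
    rw [histMean_succ, ← histMean_mul_left]
    congr 1; ext ω
    rw [stubMean_count]; ring
  rw [h2] at h1
  refine h1.trans ?_
  rw [one_div_mul_eq_div, div_le_iff₀ (by positivity)]
  linarith [histMean_risingSq_le hm t]

/-! ### The mean degree of the target block -/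

/-- The conditional expectation of the degree of the target block of the edge `t`. -/
noncomputable def meanWeight (m t : ℕ) (ω : ℕ → ℕ) : ℝ :=
  sumCount (fun k => k) (stubs m ω t) / (2 * t + 1)

/-- Partial sums of the series `∑ 1 / (2 a + 1)`. -/
noncomputable def oddHarmonic (T : ℕ) : ℝ := ∑ a ∈ Finset.range T, 1 / (2 * (a : ℝ) + 1)

/-- The approximate expectation of `meanWeight m T`. -/
noncomputable def meanWeightCentre (m T : ℕ) : ℝ :=
  1 + ∑ a ∈ Finset.range T, (2 + 2 * (((a + 1) % m : ℕ) : ℝ)) / (2 * a + 3)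

theorem stubMean_count_id (t : ℕ) :
    stubMean m t (fun ω => ((stubs m ω t).count (ω t) : ℝ)) = meanWeight m t := by
  ext ω; exact stubMean_count (fun k => (k : ℝ)) t ω

theorem dependsOn_meanWeight (t : ℕ) : DependsOn (meanWeight m t) (Set.Iio t) :=
  dependsOn_stubs (fun S => sumCount (fun k => k) S / (2 * t + 1)) t

theorem dependsOn_count {φ : ℕ → ℝ} (t : ℕ) :
    DependsOn (fun ω => φ ((stubs m ω t).count (ω t))) (Set.Iio (t + 1)) := by
  intro ω ω' h
  simp only [stubs_congr (m := m) (t := t) fun a ha => h a (by simp; omega), h t (by simp)]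

theorem meanWeight_nonneg (t : ℕ) (ω : ℕ → ℕ) : 0 ≤ meanWeight m t ω := by
  refine div_nonneg (Multiset.sum_nonneg fun x hx => ?_) (by positivity)
  obtain ⟨i, -, rfl⟩ := Multiset.mem_map.mp hx
  positivity

/-- The number of edges up to `t` that point to the block of `t + 1`. -/
def ownHits (m t : ℕ) (ω : ℕ → ℕ) : ℕ :=
  ((Finset.range (t + 1)).filter fun b => ω b = (t + 1) / m).card

/-- Raising a degree `k` by one adds `2k + 1` to `∑ d²`; this happens for the target block and then
for the block of `t + 1`. The first bracket has conditional mean zero. -/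
theorem meanWeight_succ (t : ℕ) (ω : ℕ → ℕ) : meanWeight m (t + 1) ω - meanWeight m t ω =
    (2 * (stubs m ω t).count (ω t) / (2 * t + 3) - 2 * meanWeight m t ω / (2 * t + 3)) +
      (2 + 2 * (((t + 1) % m : ℕ) : ℝ)) / (2 * t + 3) + 2 * ownHits m t ω / (2 * t + 3) := by
  have h1 : (ω t ::ₘ stubs m ω t).count ((t + 1) / m) = (t + 1) % m + ownHits m t ω := by
    rw [← card_block_init, Multiset.count_cons, count_stubs_eq, ownHits,
      Finset.range_add_one (n := t), Finset.filter_insert (p := fun a => ω a = (t + 1) / m)]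
    simp only [eq_comm (b := ω t)]
    split_ifs <;> simp [Finset.card_insert_of_notMem] <;> omega
  have h2 : (2 * (t : ℝ) + 1) ≠ 0 := by positivity
  have h3 : (2 * (t : ℝ) + 3) ≠ 0 := by positivity
  have h4 : (2 * ((t : ℝ) + 1) + 1) ≠ 0 := by positivity
  simp only [meanWeight, stubs]
  rw [sumCount_cons, sumCount_cons, h1]
  push_cast
  field_simp
  ring

theorem meanWeight_sub_centre (T : ℕ) (ω : ℕ → ℕ) : meanWeight m T ω - meanWeightCentre m T =
    ∑ t ∈ Finset.range T,
      (2 * (stubs m ω t).count (ω t) / (2 * t + 3) - 2 * meanWeight m t ω / (2 * t + 3)) +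
    ∑ t ∈ Finset.range T, 2 * (ownHits m t ω : ℝ) / (2 * t + 3) := by
  have h0 : meanWeight m 0 ω = 1 := by simp [meanWeight, sumCount, stubs]
  have h1 := Finset.sum_range_sub (fun t => meanWeight m t ω) T
  rw [h0] at h1
  simp only [meanWeight_succ, Finset.sum_add_distrib] at h1
  rw [meanWeightCentre]
  linarith

theorem oddHarmonic_nonneg (T : ℕ) : 0 ≤ oddHarmonic T :=
  Finset.sum_nonneg fun _ _ => by positivity

theorem oddHarmonic_mono : Monotone oddHarmonic := by
  refine monotone_nat_of_le_succ fun T => ?_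
  rw [oddHarmonic, oddHarmonic, Finset.sum_range_succ]
  have : (0 : ℝ) ≤ 1 / (2 * (T : ℝ) + 1) := by positivity
  linarith

theorem sum_inv_odd_sq_le (T : ℕ) :
    ∑ a ∈ Finset.range T, 1 / (2 * (a : ℝ) + 1) ^ 2 ≤ 2 := by
  have : ∑ a ∈ Finset.range T, 1 / (2 * (a : ℝ) + 1) ^ 2 ≤ 2 * (1 - 1 / (2 * (T : ℝ) + 1)) := by
    induction T with
    | zero => simp
    | succ T ih =>
      rw [Finset.sum_range_succ]
      -- Each term is dominated by a telescoping difference.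
      have : 1 / (2 * (T : ℝ) + 1) ^ 2 ≤
          2 * (1 / (2 * (T : ℝ) + 1)) - 2 * (1 / (2 * ((T + 1 : ℕ) : ℝ) + 1)) := by
        have e : 2 * (1 / (2 * (T : ℝ) + 1)) - 2 * (1 / (2 * ((T + 1 : ℕ) : ℝ) + 1)) =
            4 / ((2 * T + 1) * (2 * T + 3)) := by
          push_cast
          have : (2 * ((T : ℝ) + 1) + 1) ≠ 0 := by positivity
          field_simp; ring
        rw [e, div_le_div_iff₀ (by positivity) (by positivity)]
        nlinarith [Nat.cast_nonneg (α := ℝ) T]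
      linarith
  have h : (0 : ℝ) ≤ 1 / (2 * (T : ℝ) + 1) := by positivity
  linarith

theorem histMean_own_le (hm : 1 ≤ m) {b T : ℕ} (hb : b < T) :
    histMean m T (fun ω => if ω b = b / m then (1 : ℝ) else 0) ≤ 2 * m / (2 * b + 1) := by
  have hd : DependsOn (fun ω : ℕ → ℕ => if ω b = b / m then (1 : ℝ) else 0)
      (Set.Iio (b + 1)) := by
    intro ω ω' h
    simp only [h b (by simp)]
  rw [histMean_of_dependsOn hb hd, histMean_succ, ← histMean_const (m := m) b (2 * m / (2 * b + 1))]
  refine histMean_mono fun ω hω => ?_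
  rw [stubMean_ite_eq]
  gcongr
  exact_mod_cast hω.count_own_le hm b

/-- By validity, an edge `b ≤ t` that hits the block of `t + 1` lies in that block, so it becomes a
loop after merging. Each such `b` is charged by at most `m` values of `t`, each with weight at most
`2 / (2b + 1)`. -/
theorem sum_ownHits_le (hm : 1 ≤ m) (T : ℕ) {ω : ℕ → ℕ} (hω : Valid m ω) :
    ∑ t ∈ Finset.range T, 2 * (ownHits m t ω : ℝ) / (2 * t + 3) ≤
      ∑ b ∈ Finset.range T, 2 * m / (2 * b + 1) * if ω b = b / m then (1 : ℝ) else 0 := by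
  have h1 : ∀ t ∈ Finset.range T, 2 * (ownHits m t ω : ℝ) / (2 * t + 3) ≤
      ∑ b ∈ Finset.range T, if (t + 1) / m = b / m then
        2 / (2 * b + 1) * (if ω b = b / m then (1 : ℝ) else 0) else 0 := by
    intro t ht
    rw [ownHits, Finset.card_filter]
    push_cast
    rw [Finset.mul_sum, Finset.sum_div]
    refine (Finset.sum_le_sum fun b hb => ?_).trans
      (Finset.sum_le_sum_of_subset_of_nonneg (Finset.range_subset_range.mpr (Finset.mem_range.mp ht))
        fun b _ _ => by split_ifs <;> positivity)
    have hb' : b ≤ t := by simpa [Nat.lt_succ_iff] using hb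
    by_cases h : ω b = (t + 1) / m
    · have h2 : (t + 1) / m = b / m :=
        le_antisymm (h ▸ hω b) (Nat.div_le_div_right (by omega))
      rw [if_pos h, if_pos h2, if_pos (h.trans h2)]
      have : (b : ℝ) ≤ t := by exact_mod_cast hb'
      rw [mul_one, mul_one]
      gcongr
      linarith
    · rw [if_neg h]
      simp only [mul_zero, zero_div]
      split_ifs <;> positivity
  refine (Finset.sum_le_sum h1).trans ?_
  rw [Finset.sum_comm]
  refine Finset.sum_le_sum fun b _ => ?_
  rw [← Finset.sum_filter, Finset.sum_const, nsmul_eq_mul]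
  have h2 : ((Finset.range T).filter fun t => (t + 1) / m = b / m).card ≤ m := by
    refine le_trans ?_ (card_block_le hm (T + 1) (b / m))
    refine Finset.card_le_card_of_injOn (· + 1) (fun t ht => ?_) fun _ _ _ _ => by simp
    simp only [Finset.coe_filter, Finset.mem_range, Set.mem_ofPred_eq] at ht ⊢
    exact ⟨by omega, ht.2⟩
  have h3 : (0 : ℝ) ≤ if ω b = b / m then (1 : ℝ) else 0 := by split_ifs <;> norm_num
  calc _ ≤ (m : ℝ) * (2 / (2 * b + 1) * if ω b = b / m then (1 : ℝ) else 0) := by gcongr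
    _ = _ := by ring

/-- A loop at `b` has probability at most `2m / (2b + 1)`, so the charges form a convergent series
`∑ 1 / (2b + 1)²`. -/
theorem histMean_sum_ownHits_le (hm : 1 ≤ m) (T : ℕ) :
    histMean m T (fun ω => ∑ t ∈ Finset.range T, 2 * (ownHits m t ω : ℝ) / (2 * t + 3)) ≤
      8 * m ^ 2 := by
  refine (histMean_mono fun ω hω => sum_ownHits_le hm T hω).trans ?_
  rw [histMean_sum]
  calc _ ≤ ∑ b ∈ Finset.range T, 4 * (m : ℝ) ^ 2 * (1 / (2 * (b : ℝ) + 1) ^ 2) := by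
        refine Finset.sum_le_sum fun b hb => ?_
        rw [histMean_mul_left]
        calc _ ≤ 2 * (m : ℝ) / (2 * b + 1) * (2 * m / (2 * b + 1)) := by
              gcongr
              exact histMean_own_le hm (Finset.mem_range.mp hb)
          _ = _ := by field_simp; ring
    _ ≤ _ := by
        rw [← Finset.mul_sum]
        nlinarith [sum_inv_odd_sq_le T, sq_nonneg (m : ℝ)]

theorem histMean_abs_meanWeight_sub_le (hm : 1 ≤ m) (T : ℕ) :
    histMean m T (fun ω => |meanWeight m T ω - meanWeightCentre m T|) ≤
      √(4 * (6 + 3 * risingSq (2 * m)) * oddHarmonic T) + 8 * m ^ 2 := by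
  set x : ℕ → (ℕ → ℕ) → ℝ := fun t ω => 2 * (stubs m ω t).count (ω t) / (2 * t + 3) with hx
  have hs : ∀ t ω, stubMean m t (x t) ω = 2 * meanWeight m t ω / (2 * t + 3) := by
    intro t ω
    have : x t = (2 / (2 * (t : ℝ) + 3)) • fun ω => ((stubs m ω t).count (ω t) : ℝ) := by
      ext ω; simp only [hx, Pi.smul_apply, smul_eq_mul]; ring
    rw [this, map_smul, stubMean_count_id]
    simp only [Pi.smul_apply, smul_eq_mul]; ring
  have hd : ∀ t, DependsOn (x t) (Set.Iio (t + 1)) := fun t =>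
    dependsOn_count (φ := fun k => 2 * (k : ℝ) / (2 * t + 3)) t
  have h1 := histMean_abs_sum_sub_stubMean_le (m := m) hd T
  have h2 : ∑ t ∈ Finset.range T, histMean m (t + 1) (fun ω => x t ω ^ 2) ≤
      4 * (6 + 3 * risingSq (2 * m)) * oddHarmonic T := by
    rw [oddHarmonic, Finset.mul_sum]
    refine Finset.sum_le_sum fun t _ => ?_
    have e : (fun ω => x t ω ^ 2) =
        fun ω => (4 / (2 * (t : ℝ) + 3) ^ 2) * ((stubs m ω t).count (ω t) : ℝ) ^ 2 := by
      ext ω; simp only [hx, div_pow]; ring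
    have hK : 0 ≤ 6 + 3 * risingSq (2 * m) := by unfold risingSq; positivity
    rw [e, histMean_mul_left]
    calc _ ≤ 4 / (2 * (t : ℝ) + 3) ^ 2 * ((6 + 3 * risingSq (2 * m)) * (2 * t + 1)) := by
          gcongr; exact histMean_count_sq_le hm t
      _ ≤ 4 / (2 * (t : ℝ) + 1) ^ 2 * ((6 + 3 * risingSq (2 * m)) * (2 * t + 1)) := by
          gcongr; norm_num
      _ = _ := by field_simp
  calc _ ≤ histMean m T (fun ω => |∑ t ∈ Finset.range T, (x t ω - stubMean m t (x t) ω)| +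
        ∑ t ∈ Finset.range T, 2 * (ownHits m t ω : ℝ) / (2 * t + 3)) := by
        refine histMean_mono fun ω _ => ?_
        rw [meanWeight_sub_centre]
        refine (abs_add_le _ _).trans ?_
        simp only [hs]
        gcongr
        exact (abs_of_nonneg (Finset.sum_nonneg fun _ _ => by positivity)).le
    _ ≤ _ := by
        rw [histMean_add]
        exact add_le_add (h1.trans (Real.sqrt_le_sqrt h2)) (histMean_sum_ownHits_le hm T)

end

/-! ### Sums with periodic coefficients -/

/-- A bounded antidifference of `a ↦ a % m - (m - 1) / 2`. -/
noncomputable def saw (m a : ℕ) : ℝ := ((a % m : ℕ) : ℝ) * (((a % m : ℕ) : ℝ) - m) / 2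

section
variable {m : ℕ}

theorem saw_succ (hm : 1 ≤ m) (a : ℕ) :
    saw m (a + 1) - saw m a = ((a % m : ℕ) : ℝ) - (m - 1) / 2 := by
  unfold saw
  have h1 := Nat.mod_lt a hm
  rcases Nat.lt_or_ge (a % m + 1) m with h | h
  · have : (a + 1) % m = a % m + 1 := by
      rw [Nat.add_mod_eq_ite]
      rcases Nat.lt_or_ge 1 m with h2 | h2
      · rw [Nat.mod_eq_of_lt h2, if_neg (by omega)]
      · omega
    rw [this]; push_cast; ring
  · have h2 : (a + 1) % m = 0 := by
      rw [← Nat.dvd_iff_mod_eq_zero]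
      refine ⟨a / m + 1, ?_⟩
      have := Nat.div_add_mod a m
      rw [mul_add]; omega
    have h3 : ((a % m : ℕ) : ℝ) = m - 1 := by
      rw [eq_sub_iff_add_eq]; exact_mod_cast (by omega : a % m + 1 = m)
    rw [h2, h3]; push_cast; ring

theorem abs_saw_le (hm : 1 ≤ m) (a : ℕ) : |saw m a| ≤ m ^ 2 := by
  have h1 : ((a % m : ℕ) : ℝ) ≤ m := by exact_mod_cast (Nat.mod_lt a hm).le
  have h0 : (0 : ℝ) ≤ ((a % m : ℕ) : ℝ) := Nat.cast_nonneg _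
  unfold saw
  rw [abs_le]
  constructor <;> nlinarith

/-- Summation by parts against the bounded antidifference `saw`: a periodic coefficient may be
replaced by its average at the cost of the total variation of `g`. -/
theorem abs_sum_mod_sub_mul_le (hm : 1 ≤ m) (g : ℕ → ℝ) (T : ℕ) :
    |∑ a ∈ Finset.range T, (((a % m : ℕ) : ℝ) - (m - 1) / 2) * g a| ≤
      m ^ 2 * (|g T| + ∑ a ∈ Finset.range T, |g (a + 1) - g a|) := by
  have h : ∑ a ∈ Finset.range T, (((a % m : ℕ) : ℝ) - (m - 1) / 2) * g a =
      saw m T * g T - ∑ a ∈ Finset.range T, saw m (a + 1) * (g (a + 1) - g a) := by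
    induction T with
    | zero => simp [saw]
    | succ T ih =>
      rw [Finset.sum_range_succ, ih, Finset.sum_range_succ, ← saw_succ hm]; ring
  rw [h, mul_add, Finset.mul_sum]
  refine (abs_sub _ _).trans (add_le_add ?_ ((Finset.abs_sum_le_sum_abs _ _).trans
    (Finset.sum_le_sum fun a _ => ?_)))
  all_goals
    rw [abs_mul]
    exact mul_le_mul_of_nonneg_right (abs_saw_le hm _) (abs_nonneg _)

/-- The drift coefficient `2 + 2 (b % m)`, with `b = a + 1`, averages to `m + 1`. -/
theorem abs_meanWeightCentre_sub_le (hm : 1 ≤ m) (T : ℕ) :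
    |meanWeightCentre m T - (m + 1) * oddHarmonic T| ≤ 4 * m ^ 2 := by
  set f : ℕ → ℝ := fun b => (((b % m : ℕ) : ℝ) - (m - 1) / 2) * (1 / (2 * (b : ℝ) + 1)) with hf
  have hm' : (1 : ℝ) ≤ m := by exact_mod_cast hm
  have h1 : |∑ b ∈ Finset.range (T + 1), f b| ≤ m ^ 2 := by
    refine (abs_sum_mod_sub_mul_le hm _ _).trans ?_
    have e : ∀ a ∈ Finset.range (T + 1),
        |1 / (2 * ((a + 1 : ℕ) : ℝ) + 1) - 1 / (2 * (a : ℝ) + 1)| =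
        1 / (2 * (a : ℝ) + 1) - 1 / (2 * ((a + 1 : ℕ) : ℝ) + 1) := by
      intro a _
      rw [abs_sub_comm, abs_of_nonneg]
      rw [sub_nonneg]
      gcongr
      simp
    rw [Finset.sum_congr rfl e, Finset.sum_range_sub', abs_of_nonneg (by positivity)]
    simp
  -- The shift `b = a + 1` leaves out `b = 0`, hence the corrections `- 1` and `- f 0`.
  have h2 : meanWeightCentre m T = 1 + (m + 1) * (∑ b ∈ Finset.range (T + 1),
      1 / (2 * (b : ℝ) + 1) - 1) + 2 * (∑ b ∈ Finset.range (T + 1), f b - f 0) := by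
    rw [meanWeightCentre, Finset.sum_range_succ' _ T, Finset.sum_range_succ' f T]
    simp only [CharP.cast_eq_zero, mul_zero, zero_add, div_one, add_sub_cancel_right]
    rw [add_assoc, Finset.mul_sum, Finset.mul_sum, ← Finset.sum_add_distrib]
    congr 1
    refine Finset.sum_congr rfl fun a _ => ?_
    simp only [hf]
    have : (2 * ((a : ℝ) + 1) + 1) ≠ 0 := by positivity
    push_cast
    field_simp
    ring
  have h3 : f 0 = -((m - 1) / 2) := by simp [hf]
  have h4 : 0 ≤ 1 / (2 * (T : ℝ) + 1) := by positivity
  have h5 : 1 / (2 * (T : ℝ) + 1) ≤ 1 := by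
    rw [div_le_one (by positivity)]; linarith [Nat.cast_nonneg (α := ℝ) T]
  rw [h2, h3, Finset.sum_range_succ, ← oddHarmonic]
  obtain ⟨h6, h7⟩ := abs_le.mp h1
  rw [abs_le]
  constructor <;> nlinarith

/-- Discrete form of `∫ H dH = H² / 2`, with the squared increments as correction. -/
theorem sum_oddHarmonic_div (T : ℕ) :
    ∑ a ∈ Finset.range T, oddHarmonic a / (2 * (a : ℝ) + 1) =
      (oddHarmonic T ^ 2 - ∑ a ∈ Finset.range T, 1 / (2 * (a : ℝ) + 1) ^ 2) / 2 := by
  induction T with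
  | zero => simp [oddHarmonic]
  | succ T ih =>
    have : oddHarmonic (T + 1) = oddHarmonic T + 1 / (2 * (T : ℝ) + 1) := by
      rw [oddHarmonic, Finset.sum_range_succ, oddHarmonic]
    rw [Finset.sum_range_succ, ih, this, Finset.sum_range_succ]
    have : (2 * (T : ℝ) + 1) ≠ 0 := by positivity
    field_simp; ring

theorem oddHarmonic_le (T : ℕ) : oddHarmonic T ≤ T := by
  calc oddHarmonic T ≤ ∑ _a ∈ Finset.range T, (1 : ℝ) := by
        refine Finset.sum_le_sum fun a _ => ?_
        rw [div_le_one (by positivity)]; linarith [Nat.cast_nonneg (α := ℝ) a]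
    _ = T := by simp

theorem abs_meanWeightCentre_le (hm : 1 ≤ m) (T : ℕ) :
    |meanWeightCentre m T| ≤ 4 * m ^ 2 * (2 * T + 1) := by
  have h1 := abs_meanWeightCentre_sub_le hm T
  have h2 := oddHarmonic_le T
  have h3 := oddHarmonic_nonneg T
  have hm' : (1 : ℝ) ≤ m := by exact_mod_cast hm
  have h4 : (m + 1) * oddHarmonic T ≤ (2 * m ^ 2) * T := by
    gcongr
    nlinarith
  have h5 : 0 ≤ (m + 1) * oddHarmonic T := by positivity
  have h6 : (0 : ℝ) ≤ m ^ 2 * T := by positivity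
  rw [abs_le] at h1 ⊢
  constructor <;> nlinarith

/-- The number of later edges in the block of `a`. -/
noncomputable def laterInBlock (m a : ℕ) : ℝ := m - 1 - ((a % m : ℕ) : ℝ)

theorem laterInBlock_nonneg (hm : 1 ≤ m) (a : ℕ) : 0 ≤ laterInBlock m a := by
  have : ((a % m : ℕ) : ℝ) + 1 ≤ m := by exact_mod_cast Nat.mod_lt a hm
  unfold laterInBlock; linarith

theorem laterInBlock_le (a : ℕ) : laterInBlock m a ≤ m := by
  unfold laterInBlock; linarith [Nat.cast_nonneg (α := ℝ) (a % m)]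

/-- `laterInBlock` is replaced by its average `(m - 1) / 2` and the centre by `(m + 1) H`. The main
term is then `(m² - 1) / 2 · ∑ H_a / (2a + 1)`, and both replacements cost only `O(1 + H)`. -/
theorem abs_sum_centre_sub_le (hm : 1 ≤ m) (T : ℕ) :
    |∑ a ∈ Finset.range T, laterInBlock m a / (2 * a + 1) * meanWeightCentre m a -
      (m ^ 2 - 1) / 4 * oddHarmonic T ^ 2| ≤ 20 * m ^ 4 * (1 + oddHarmonic T) := by
  have hm' : (1 : ℝ) ≤ m := by exact_mod_cast hm
  have hH := oddHarmonic_nonneg T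
  set g : ℕ → ℝ := fun a => meanWeightCentre m a / (2 * a + 1) with hg
  have hgT : |g T| ≤ 4 * m ^ 2 := by
    rw [hg, abs_div, abs_of_pos (a := 2 * (T : ℝ) + 1) (by positivity), div_le_iff₀ (by positivity)]
    exact abs_meanWeightCentre_le hm T
  -- Boundedness of `g` suffices: the total variation is then `O(H)`, well below the main order
  -- `H²`.
  have hdg : ∀ a ∈ Finset.range T, |g (a + 1) - g a| ≤ 10 * m ^ 2 * (1 / (2 * (a : ℝ) + 1)) := by
    intro a _
    have e : g (a + 1) - g a = ((2 + 2 * (((a + 1) % m : ℕ) : ℝ)) / (2 * a + 3) -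
        2 * (meanWeightCentre m a / (2 * a + 1))) * (1 / (2 * a + 3)) := by
      have : (2 * ((a : ℝ) + 1) + 1) ≠ 0 := by positivity
      simp only [hg, meanWeightCentre, Finset.sum_range_succ]
      push_cast
      field_simp
      ring
    have h1 : |meanWeightCentre m a / (2 * a + 1)| ≤ 4 * m ^ 2 := by
      rw [abs_div, abs_of_pos (a := 2 * (a : ℝ) + 1) (by positivity), div_le_iff₀ (by positivity)]
      exact abs_meanWeightCentre_le hm a
    have h2 : (((a + 1) % m : ℕ) : ℝ) + 1 ≤ m := by exact_mod_cast Nat.mod_lt (a + 1) hm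
    have h3 : (2 + 2 * (((a + 1) % m : ℕ) : ℝ)) / (2 * a + 3) ≤ 2 * m ^ 2 := by
      rw [div_le_iff₀ (by positivity)]
      nlinarith [Nat.cast_nonneg (α := ℝ) a]
    have h4 : 0 ≤ (2 + 2 * (((a + 1) % m : ℕ) : ℝ)) / (2 * a + 3) := by positivity
    rw [e, abs_mul, abs_of_pos (a := 1 / (2 * (a : ℝ) + 3)) (by positivity)]
    rw [abs_le] at h1
    gcongr
    · rw [abs_le]; constructor <;> linarith
    · norm_num
  have h1 := abs_sum_mod_sub_mul_le hm g T
  have h2 : |∑ a ∈ Finset.range T, (((a % m : ℕ) : ℝ) - (m - 1) / 2) * g a| ≤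
      m ^ 2 * (4 * m ^ 2 + 10 * m ^ 2 * oddHarmonic T) := by
    refine h1.trans ?_
    gcongr
    rw [oddHarmonic, Finset.mul_sum]
    exact Finset.sum_le_sum hdg
  have h3 : |∑ a ∈ Finset.range T,
      (meanWeightCentre m a - (m + 1) * oddHarmonic a) * (1 / (2 * (a : ℝ) + 1))| ≤
      4 * m ^ 2 * oddHarmonic T := by
    rw [oddHarmonic, Finset.mul_sum]
    refine (Finset.abs_sum_le_sum_abs _ _).trans (Finset.sum_le_sum fun a _ => ?_)
    rw [abs_mul, abs_of_pos (a := 1 / (2 * (a : ℝ) + 1)) (by positivity)]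
    gcongr
    exact abs_meanWeightCentre_sub_le hm a
  have e : ∑ a ∈ Finset.range T, laterInBlock m a / (2 * a + 1) * meanWeightCentre m a -
      (m ^ 2 - 1) / 4 * oddHarmonic T ^ 2 =
      (m - 1) / 2 * (∑ a ∈ Finset.range T,
        (meanWeightCentre m a - (m + 1) * oddHarmonic a) * (1 / (2 * (a : ℝ) + 1))) -
      ∑ a ∈ Finset.range T, (((a % m : ℕ) : ℝ) - (m - 1) / 2) * g a -
      (m ^ 2 - 1) / 4 * ∑ a ∈ Finset.range T, 1 / (2 * (a : ℝ) + 1) ^ 2 := by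
    have h4 := sum_oddHarmonic_div T
    have h5 : ∑ a ∈ Finset.range T, laterInBlock m a / (2 * a + 1) * meanWeightCentre m a =
      (m - 1) / 2 * (∑ a ∈ Finset.range T,
        (meanWeightCentre m a - (m + 1) * oddHarmonic a) * (1 / (2 * (a : ℝ) + 1))) -
      ∑ a ∈ Finset.range T, (((a % m : ℕ) : ℝ) - (m - 1) / 2) * g a +
      (m ^ 2 - 1) / 2 * ∑ a ∈ Finset.range T, oddHarmonic a / (2 * (a : ℝ) + 1) := by
      rw [Finset.mul_sum, Finset.mul_sum, ← Finset.sum_sub_distrib, ← Finset.sum_add_distrib]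
      refine Finset.sum_congr rfl fun a _ => ?_
      simp only [hg, laterInBlock]
      field_simp
      ring
    rw [h5, h4]; ring
  have h6 := sum_inv_odd_sq_le T
  have h7 : 0 ≤ ∑ a ∈ Finset.range T, 1 / (2 * (a : ℝ) + 1) ^ 2 :=
    Finset.sum_nonneg fun _ _ => by positivity
  have h8 : |(m - 1) / 2 * (∑ a ∈ Finset.range T,
        (meanWeightCentre m a - (m + 1) * oddHarmonic a) * (1 / (2 * (a : ℝ) + 1)))| ≤
      (m : ℝ) ^ 2 * (4 * (m : ℝ) ^ 2 * oddHarmonic T) := by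
    rw [abs_mul, abs_of_nonneg (by linarith)]
    gcongr
    nlinarith
  have h9 : |((m : ℝ) ^ 2 - 1) / 4 * ∑ a ∈ Finset.range T, 1 / (2 * (a : ℝ) + 1) ^ 2| ≤
      ((m : ℝ) ^ 2 * (m : ℝ) ^ 2) * 2 := by
    rw [abs_of_nonneg (mul_nonneg (by nlinarith) h7)]
    have : (1 : ℝ) ≤ (m : ℝ) ^ 2 := by nlinarith
    gcongr
    nlinarith
  rw [e]
  refine (abs_sub _ _).trans ((add_le_add ((abs_sub _ _).trans (add_le_add h8 h2)) h9).trans ?_)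
  nlinarith [show (0 : ℝ) ≤ (m : ℝ) ^ 4 by positivity, show (0 : ℝ) ≤ (m : ℝ) ^ 4 * oddHarmonic T by positivity]

end

/-! ### Concentration of the number of parallel pairs -/

/-- The earlier edges in the block of `t`. -/
def earlier (m t : ℕ) : Finset ℕ := (Finset.range t).filter fun a => a / m = t / m

/-- The number of earlier edges in the block of `t` that are parallel to `t`. -/
noncomputable def newPairs (m t : ℕ) (ω : ℕ → ℕ) : ℝ :=
  ∑ a ∈ earlier m t, if ω t = ω a ∧ ω a ≠ t / m then 1 else 0

section
variable {m : ℕ}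

theorem card_earlier_le (hm : 1 ≤ m) (t : ℕ) : (earlier m t).card ≤ m := card_block_le hm t _

/-- The range consists of `n` complete blocks, so every later edge in the block of `a` is counted
and `f a` occurs `m - 1 - a % m` times. -/
theorem sum_sum_earlier (hm : 1 ≤ m) (n : ℕ) (f : ℕ → ℝ) :
    ∑ t ∈ Finset.range (n * m), ∑ a ∈ earlier m t, f a =
      ∑ a ∈ Finset.range (n * m), laterInBlock m a * f a := by
  have h : ∑ t ∈ Finset.range (n * m), ∑ a ∈ earlier m t, f a =
      ∑ a ∈ Finset.range (n * m),
        ∑ t ∈ (Finset.range (n * m)).filter (fun t => a < t ∧ a / m = t / m), f a := by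
    refine Finset.sum_comm' fun t a => ?_
    simp only [earlier, Finset.mem_filter, Finset.mem_range]
    constructor
    · rintro ⟨h1, h2, h3⟩; exact ⟨⟨h1, h2, h3⟩, h2.trans h1⟩
    · rintro ⟨⟨h1, h2, h3⟩, -⟩; exact ⟨h1, h2, h3⟩
  rw [h]
  refine Finset.sum_congr rfl fun a ha => ?_
  have hs : (Finset.range (n * m)).filter (fun t => a < t ∧ a / m = t / m) =
      Finset.Ico (a + 1) (a / m * m + m) := by
    ext t
    simp only [Finset.mem_filter, Finset.mem_range, Finset.mem_Ico] at ha ⊢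
    rw [eq_comm, Nat.div_eq_iff (by omega)]
    have h1 : a / m + 1 ≤ n := (Nat.div_lt_iff_lt_mul hm).mpr ha
    have h2 := Nat.mul_le_mul_right m h1
    rw [add_mul, one_mul] at h2
    have h3 := Nat.div_mul_le_self a m
    omega
  have h4 := Nat.div_add_mod' a m
  have h5 := Nat.mod_lt a hm
  have h6 : a / m * m + m - (a + 1) = m - 1 - a % m := by omega
  rw [hs, Finset.sum_const, Nat.card_Ico, h6, nsmul_eq_mul, laterInBlock, Nat.cast_sub (by omega),
    Nat.cast_sub hm]
  simp

theorem dependsOn_newPairs (t : ℕ) : DependsOn (newPairs m t) (Set.Iio (t + 1)) := by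
  intro ω ω' h
  refine Finset.sum_congr rfl fun a ha => ?_
  have ha' : a < t := Finset.mem_range.mp (Finset.mem_filter.mp ha).1
  rw [h t (by simp), h a (by simp; omega)]

theorem newPairs_nonneg (t : ℕ) (ω : ℕ → ℕ) : 0 ≤ newPairs m t ω :=
  Finset.sum_nonneg fun _ _ => by split_ifs <;> norm_num

theorem newPairs_le (hm : 1 ≤ m) (t : ℕ) (ω : ℕ → ℕ) : newPairs m t ω ≤ m := by
  calc newPairs m t ω ≤ ∑ _a ∈ earlier m t, (1 : ℝ) :=
        Finset.sum_le_sum fun _ _ => by split_ifs <;> norm_num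
    _ ≤ m := by simpa using card_earlier_le hm t

theorem stubMean_newPairs (t : ℕ) (ω : ℕ → ℕ) : stubMean m t (newPairs m t) ω =
    ∑ a ∈ earlier m t, if ω a ≠ t / m then
      ((stubs m ω t).count (ω a) : ℝ) / (2 * t + 1) else 0 := by
  have : newPairs m t =
      ∑ a ∈ earlier m t, fun ω => if ω t = ω a ∧ ω a ≠ t / m then (1 : ℝ) else 0 := by
    ext ω; simp [newPairs]
  rw [this, map_sum, Finset.sum_apply]
  refine Finset.sum_congr rfl fun a ha => ?_
  have ha' : a < t := Finset.mem_range.mp (Finset.mem_filter.mp ha).1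
  rw [stubMean_apply]
  simp only [Function.update_self, Function.update_of_ne (ne_of_lt ha')]
  by_cases h : ω a = t / m
  · simp [h]
  · simp only [h, not_false_eq_true, and_true, ne_eq, if_true]
    rw [sum_map_ite_eq, mul_one]

/-! ### Target shares and their conditional means -/

/-- The relative degree of the target block of the edge `a`. -/
noncomputable def targetShare (m a : ℕ) (ω : ℕ → ℕ) : ℝ :=
  ((stubs m ω a).count (ω a) : ℝ) / (2 * a + 1)

theorem targetShare_nonneg (a : ℕ) (ω : ℕ → ℕ) : 0 ≤ targetShare m a ω := by
  unfold targetShare; positivity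

theorem targetShare_le_one (a : ℕ) (ω : ℕ → ℕ) : targetShare m a ω ≤ 1 := by
  unfold targetShare
  rw [div_le_one (by positivity)]
  exact_mod_cast count_stubs_le ω a (ω a)

theorem dependsOn_targetShare (a : ℕ) : DependsOn (targetShare m a) (Set.Iio (a + 1)) :=
  dependsOn_count (φ := fun k => (k : ℝ) / (2 * a + 1)) a

theorem stubMean_targetShare (a : ℕ) (ω : ℕ → ℕ) :
    stubMean m a (targetShare m a) ω = meanWeight m a ω / (2 * a + 1) := by
  have : targetShare m a =
      (1 / (2 * (a : ℝ) + 1)) • fun ω => ((stubs m ω a).count (ω a) : ℝ) := by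
    ext ω; simp only [targetShare, Pi.smul_apply, smul_eq_mul]; ring
  rw [this, map_smul, stubMean_count_id]
  simp only [Pi.smul_apply, smul_eq_mul]; ring

theorem histMean_targetShare {a T : ℕ} (h : a < T) :
    histMean m T (targetShare m a) = histMean m a (meanWeight m a) / (2 * a + 1) := by
  rw [histMean_of_dependsOn h (dependsOn_targetShare a), histMean_succ, div_eq_inv_mul,
    ← histMean_mul_left]
  congr 1; ext ω
  rw [stubMean_targetShare]; ring

/-- Times `a` and `t` differ by at most `m`, so the degree of `ω a` and the total degree both change
by `O(m)`. If `ω a` is the common block, no pair arises, but then the share itself is at most `2m /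
(2a + 1)`. -/
theorem abs_stubMean_newPairs_sub_le (hm : 1 ≤ m) (t : ℕ) {ω : ℕ → ℕ} (hω : Valid m ω) :
    |stubMean m t (newPairs m t) ω - ∑ a ∈ earlier m t, targetShare m a ω| ≤
      ∑ a ∈ earlier m t, 2 * m / (2 * (a : ℝ) + 1) := by
  rw [stubMean_newPairs, ← Finset.sum_sub_distrib]
  refine (Finset.abs_sum_le_sum_abs _ _).trans (Finset.sum_le_sum fun a ha => ?_)
  obtain ⟨ha1, ha2⟩ := Finset.mem_filter.mp ha
  have ha3 := Finset.mem_range.mp ha1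
  have hat : (a : ℝ) ≤ t := by exact_mod_cast ha3.le
  unfold targetShare
  by_cases h : ω a = t / m
  · have h1 : ((stubs m ω a).count (ω a) : ℝ) ≤ 2 * m := by
      rw [h, ← ha2]; exact_mod_cast hω.count_own_le hm a
    rw [if_neg (by simpa using h), zero_sub, abs_neg, abs_of_nonneg (by positivity)]
    gcongr
  · rw [if_pos h]
    have hk : t ≤ a + m := by
      have h1 := (Nat.div_eq_iff (by omega)).mp ha2.symm
      have h2 := Nat.div_mul_le_self a m
      omega
    obtain ⟨k, rfl⟩ := Nat.exists_eq_add_of_le ha3.le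
    have hkm : (k : ℝ) ≤ m := by exact_mod_cast (by omega : k ≤ m)
    have h1 : ((stubs m ω a).count (ω a) : ℝ) ≤ (stubs m ω (a + k)).count (ω a) := by
      exact_mod_cast count_stubs_mono ω (ω a) (Nat.le_add_right a k)
    have h2 : ((stubs m ω (a + k)).count (ω a) : ℝ) ≤ (stubs m ω a).count (ω a) + 2 * k := by
      exact_mod_cast count_stubs_add_le ω (ω a) a k
    have h3 : ((stubs m ω a).count (ω a) : ℝ) ≤ 2 * a + 1 := by
      exact_mod_cast count_stubs_le ω a (ω a)
    set x : ℝ := ((stubs m ω a).count (ω a) : ℝ)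
    set y : ℝ := ((stubs m ω (a + k)).count (ω a) : ℝ)
    have hx : 0 ≤ x := Nat.cast_nonneg _
    push_cast
    have e : y / (2 * ((a : ℝ) + k) + 1) - x / (2 * a + 1) =
        ((y - x) - 2 * k * (x / (2 * a + 1))) / (2 * (a + k) + 1) := by
      field_simp; ring
    have h4 : x / (2 * a + 1) ≤ 1 := (div_le_one (by positivity)).mpr h3
    have h5 : 0 ≤ x / (2 * a + 1) := by positivity
    have hk0 : (0 : ℝ) ≤ k := Nat.cast_nonneg _
    rw [e, abs_div, abs_of_pos (a := 2 * ((a : ℝ) + k) + 1) (by positivity)]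
    gcongr
    · rw [abs_le]; constructor <;> nlinarith
    · linarith

/-- `1 + H` where `H` is the odd harmonic sum; the scale `log T`. -/
noncomputable def scale (T : ℕ) : ℝ := 1 + oddHarmonic T

theorem one_le_scale (T : ℕ) : 1 ≤ scale T := by
  unfold scale; linarith [oddHarmonic_nonneg T]

theorem exists_histMean_abs_meanWeight_sub_le (hm : 1 ≤ m) : ∃ C : ℝ, 0 ≤ C ∧ ∀ T,
    histMean m T (fun ω => |meanWeight m T ω - meanWeightCentre m T|) ≤ C * √(scale T) := by
  set K := 6 + 3 * risingSq (2 * m) with hK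
  have hK0 : 0 ≤ K := by rw [hK]; unfold risingSq; positivity
  refine ⟨√(4 * K) + 8 * m ^ 2, by positivity, fun T => ?_⟩
  refine (histMean_abs_meanWeight_sub_le hm T).trans ?_
  have h1 : 1 ≤ √(scale T) := Real.one_le_sqrt.mpr (one_le_scale T)
  have h2 : √(4 * K * oddHarmonic T) ≤ √(4 * K) * √(scale T) := by
    rw [← Real.sqrt_mul (by positivity)]
    refine Real.sqrt_le_sqrt ?_
    gcongr
    unfold scale; linarith
  have h3 : 8 * (m : ℝ) ^ 2 ≤ 8 * m ^ 2 * √(scale T) := le_mul_of_one_le_right (by positivity) h1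
  rw [add_mul]; linarith

theorem exists_histMean_meanWeight_le (hm : 1 ≤ m) : ∃ C : ℝ, 0 ≤ C ∧ ∀ T,
    histMean m T (meanWeight m T) ≤ C * scale T := by
  obtain ⟨C, hC, h⟩ := exists_histMean_abs_meanWeight_sub_le hm
  refine ⟨C + (m + 1) + 4 * m ^ 2, by positivity, fun T => ?_⟩
  have h1 : histMean m T (meanWeight m T) ≤ histMean m T (fun ω =>
      |meanWeight m T ω - meanWeightCentre m T| + meanWeightCentre m T) :=
    histMean_mono fun ω _ => by linarith [le_abs_self (meanWeight m T ω - meanWeightCentre m T)]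
  rw [histMean_add, histMean_const] at h1
  have h2 := (abs_le.mp (abs_meanWeightCentre_sub_le hm T)).2
  have hs := one_le_scale T
  have h3 : √(scale T) ≤ scale T := by
    rw [Real.sqrt_le_left (by linarith)]; nlinarith
  have h4 : C * √(scale T) ≤ C * scale T := by gcongr
  have h5 : ((m : ℝ) + 1) * oddHarmonic T ≤ (m + 1) * scale T := by
    gcongr; unfold scale; linarith
  have h6 : 4 * (m : ℝ) ^ 2 ≤ 4 * m ^ 2 * scale T := le_mul_of_one_le_right (by positivity) hs
  have h7 := h T
  linarith

theorem scale_mono : Monotone scale := fun _ _ h => by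
  unfold scale; linarith [oddHarmonic_mono h]

theorem sum_later_div_le (T : ℕ) {f : ℕ → ℝ} {B : ℝ} (hB : 0 ≤ B)
    (hf : ∀ a < T, f a ≤ B) (hf0 : ∀ a, 0 ≤ f a) :
    ∑ a ∈ Finset.range T, laterInBlock m a * (f a / (2 * a + 1)) ≤ m * B * scale T := by
  calc _ ≤ ∑ a ∈ Finset.range T, m * B * (1 / (2 * (a : ℝ) + 1)) := by
        refine Finset.sum_le_sum fun a ha => ?_
        have h1 := hf a (Finset.mem_range.mp ha)
        calc _ ≤ (m : ℝ) * (f a / (2 * a + 1)) :=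
              mul_le_mul_of_nonneg_right (laterInBlock_le a) (div_nonneg (hf0 a) (by positivity))
          _ ≤ m * (B / (2 * a + 1)) := by gcongr
          _ = _ := by ring
    _ = m * B * oddHarmonic T := by rw [← Finset.mul_sum, oddHarmonic]
    _ ≤ _ := by gcongr; unfold scale; linarith

theorem histMean_meanWeight_nonneg (t : ℕ) : 0 ≤ histMean m t (meanWeight m t) :=
  histMean_nonneg fun ω _ => meanWeight_nonneg t ω

/-- The number of parallel pairs exceeds its compensator by `O(log)` in mean. -/
theorem exists_histMean_abs_newPairs_sub_le (hm : 1 ≤ m) : ∃ C : ℝ, 0 ≤ C ∧ ∀ n,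
    histMean m (n * m) (fun ω => |∑ t ∈ Finset.range (n * m),
      (newPairs m t ω - stubMean m t (newPairs m t) ω)|) ≤ C * scale (n * m) := by
  obtain ⟨C, hC, h⟩ := exists_histMean_meanWeight_le hm
  refine ⟨√(m * (m * (C + 2 * m))), Real.sqrt_nonneg _, fun n => ?_⟩
  have hs := one_le_scale (n * m)
  refine (histMean_abs_sum_sub_stubMean_le dependsOn_newPairs (n * m)).trans ?_
  have h1 : ∀ t ∈ Finset.range (n * m), histMean m (t + 1) (fun ω => newPairs m t ω ^ 2) ≤
      m * ∑ a ∈ earlier m t, (histMean m a (meanWeight m a) + 2 * m) / (2 * a + 1) := by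
    intro t _
    -- As `newPairs` is at most `m`, its second moment is controlled by its mean.
    have h2 : histMean m (t + 1) (fun ω => newPairs m t ω ^ 2) ≤
        histMean m (t + 1) (fun ω => m * newPairs m t ω) := histMean_mono fun ω _ => by
      rw [sq]; exact mul_le_mul_of_nonneg_right (newPairs_le hm t ω) (newPairs_nonneg t ω)
    have h3 : histMean m t (stubMean m t (newPairs m t)) ≤ histMean m t (fun ω =>
        ∑ a ∈ earlier m t, targetShare m a ω + ∑ a ∈ earlier m t, 2 * m / (2 * (a : ℝ) + 1)) :=
      histMean_mono fun ω hω => by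
        linarith [(abs_le.mp (abs_stubMean_newPairs_sub_le hm t hω)).2]
    rw [histMean_add, histMean_const, histMean_sum, ← Finset.sum_add_distrib] at h3
    rw [histMean_mul_left, histMean_succ] at h2
    refine h2.trans (mul_le_mul_of_nonneg_left (h3.trans_eq ?_) (Nat.cast_nonneg _))
    refine Finset.sum_congr rfl fun a ha => ?_
    rw [histMean_targetShare (Finset.mem_range.mp (Finset.mem_filter.mp ha).1), add_div]
  rw [← Real.sqrt_sq (by linarith : 0 ≤ scale (n * m)), ← Real.sqrt_mul (by positivity)]
  refine Real.sqrt_le_sqrt ((Finset.sum_le_sum h1).trans ?_)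
  rw [← Finset.mul_sum, sum_sum_earlier hm n fun a =>
    (histMean m a (meanWeight m a) + 2 * m) / (2 * a + 1)]
  have h4 := sum_later_div_le (m := m) (n * m)
    (f := fun a => histMean m a (meanWeight m a) + 2 * m)
    (B := (C + 2 * m) * scale (n * m)) (by positivity) (fun a ha => by
      have h5 := h a
      have h6 : C * scale a ≤ C * scale (n * m) := by
        gcongr; exact scale_mono ha.le
      have h7 : 2 * (m : ℝ) ≤ 2 * m * scale (n * m) := le_mul_of_one_le_right (by positivity) hs
      rw [add_mul]; linarith) (fun a => by have := histMean_meanWeight_nonneg (m := m) a; positivity)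
  calc _ ≤ (m : ℝ) * (m * ((C + 2 * m) * scale (n * m)) * scale (n * m)) := by gcongr
    _ = _ := by ring

/-- Second compensation: the shares are at most `1`, so the variance is again bounded by the mean,
which is `O(log²)`. -/
theorem exists_histMean_abs_targetShare_sub_le (hm : 1 ≤ m) : ∃ C : ℝ, 0 ≤ C ∧ ∀ T,
    histMean m T (fun ω => |∑ a ∈ Finset.range T, (laterInBlock m a * targetShare m a ω -
      laterInBlock m a * (meanWeight m a ω / (2 * a + 1)))|) ≤ C * scale T := by
  obtain ⟨C, hC, h⟩ := exists_histMean_meanWeight_le hm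
  refine ⟨√(m * (m * C)), Real.sqrt_nonneg _, fun T => ?_⟩
  have hs := one_le_scale T
  set x : ℕ → (ℕ → ℕ) → ℝ := fun a ω => laterInBlock m a * targetShare m a ω with hx
  have hd : ∀ a, DependsOn (x a) (Set.Iio (a + 1)) := fun a ω ω' h =>
    congrArg (laterInBlock m a * ·) (dependsOn_targetShare a h)
  have hsm : ∀ a ω, stubMean m a (x a) ω =
      laterInBlock m a * (meanWeight m a ω / (2 * a + 1)) := by
    intro a ω
    have : x a = laterInBlock m a • targetShare m a := rfl
    rw [this, map_smul, Pi.smul_apply, stubMean_targetShare, smul_eq_mul]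
  have h1 := histMean_abs_sum_sub_stubMean_le (m := m) hd T
  simp only [hsm] at h1
  refine h1.trans ?_
  rw [← Real.sqrt_sq (by linarith : 0 ≤ scale T), ← Real.sqrt_mul (by positivity)]
  refine Real.sqrt_le_sqrt ?_
  have h2 : ∀ a ∈ Finset.range T, histMean m (a + 1) (fun ω => x a ω ^ 2) ≤
      m * (laterInBlock m a * (histMean m a (meanWeight m a) / (2 * a + 1))) := by
    intro a _
    rw [← histMean_targetShare (Nat.lt_succ_self a), ← histMean_mul_left, ← histMean_mul_left]
    refine histMean_mono fun ω _ => ?_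
    have h3 := laterInBlock_nonneg hm a
    have h4 := targetShare_nonneg (m := m) a ω
    have h5 : x a ω ≤ m := by
      calc _ ≤ (m : ℝ) * 1 := mul_le_mul (laterInBlock_le a) (targetShare_le_one a ω) h4
            (Nat.cast_nonneg _)
        _ = m := mul_one _
    rw [sq]
    exact mul_le_mul_of_nonneg_right h5 (mul_nonneg h3 h4)
  refine (Finset.sum_le_sum h2).trans ?_
  rw [← Finset.mul_sum]
  have h4 := sum_later_div_le (m := m) T
    (f := fun a => histMean m a (meanWeight m a))
    (B := C * scale T) (by positivity) (fun a ha => (h a).trans (by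
      gcongr; exact scale_mono ha.le)) (fun a => histMean_meanWeight_nonneg a)
  calc _ ≤ (m : ℝ) * (m * (C * scale T) * scale T) := by gcongr
    _ = _ := by ring

theorem exists_histMean_abs_sum_centre_sub_le (hm : 1 ≤ m) : ∃ C : ℝ, 0 ≤ C ∧ ∀ T,
    histMean m T (fun ω => ∑ a ∈ Finset.range T, laterInBlock m a / (2 * a + 1) *
      |meanWeight m a ω - meanWeightCentre m a|) ≤ C * (scale T * √(scale T)) := by
  obtain ⟨C, hC, h⟩ := exists_histMean_abs_meanWeight_sub_le hm
  refine ⟨m * C, by positivity, fun T => ?_⟩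
  have hs := one_le_scale T
  rw [histMean_sum]
  have e : ∀ a ∈ Finset.range T, histMean m T (fun ω => laterInBlock m a / (2 * a + 1) *
      |meanWeight m a ω - meanWeightCentre m a|) = laterInBlock m a *
      (histMean m a (fun ω => |meanWeight m a ω - meanWeightCentre m a|) / (2 * a + 1)) := by
    intro a ha
    rw [histMean_mul_left, histMean_of_dependsOn (Finset.mem_range.mp ha).le]
    · ring
    · intro ω ω' h; simp only [dependsOn_meanWeight a h]
  rw [Finset.sum_congr rfl e]
  refine (sum_later_div_le (m := m) T (B := C * √(scale T)) (by positivity) (fun a ha =>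
    (h a).trans ?_) fun a => histMean_nonneg fun _ _ => abs_nonneg _).trans_eq (by ring)
  gcongr; exact scale_mono ha.le

/-- The dominant error comes from the fluctuation `√log` of `meanWeight`, summed against `1 / (2a +
1)`; all other errors are `O(log)`. -/
theorem exists_histMean_abs_sum_newPairs_sub_le (hm : 1 ≤ m) : ∃ C : ℝ, 0 ≤ C ∧ ∀ n,
    histMean m (n * m) (fun ω => |∑ t ∈ Finset.range (n * m), newPairs m t ω -
      (m ^ 2 - 1) / 4 * oddHarmonic (n * m) ^ 2|) ≤ C * (scale (n * m) * √(scale (n * m))) := by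
  obtain ⟨C₁, hC₁, h₁⟩ := exists_histMean_abs_newPairs_sub_le hm
  obtain ⟨C₂, hC₂, h₂⟩ := exists_histMean_abs_targetShare_sub_le hm
  obtain ⟨C₃, hC₃, h₃⟩ := exists_histMean_abs_sum_centre_sub_le hm
  refine ⟨C₁ + m * (2 * m) + C₂ + C₃ + 20 * m ^ 4, by positivity, fun n => ?_⟩
  set T := n * m with hT
  have hs := one_le_scale T
  have h0 : scale T ≤ scale T * √(scale T) :=
    le_mul_of_one_le_right (by linarith) (Real.one_le_sqrt.mpr hs)
  have key : ∀ ω, Valid m ω → |∑ t ∈ Finset.range T, newPairs m t ω -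
      (m ^ 2 - 1) / 4 * oddHarmonic T ^ 2| ≤
      |∑ t ∈ Finset.range T, (newPairs m t ω - stubMean m t (newPairs m t) ω)| +
      |∑ a ∈ Finset.range T, (laterInBlock m a * targetShare m a ω -
        laterInBlock m a * (meanWeight m a ω / (2 * a + 1)))| +
      ∑ a ∈ Finset.range T, laterInBlock m a / (2 * a + 1) *
        |meanWeight m a ω - meanWeightCentre m a| +
      (m * (2 * m) * scale T + 20 * m ^ 4 * scale T) := by
    intro ω hω
    have k1 : |∑ t ∈ Finset.range T, stubMean m t (newPairs m t) ω -
        ∑ a ∈ Finset.range T, laterInBlock m a * targetShare m a ω| ≤ m * (2 * m) * scale T := by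
      rw [← sum_sum_earlier hm, ← Finset.sum_sub_distrib]
      refine (Finset.abs_sum_le_sum_abs _ _).trans ((Finset.sum_le_sum fun t _ =>
        abs_stubMean_newPairs_sub_le hm t hω).trans ?_)
      rw [sum_sum_earlier hm n fun a => 2 * m / (2 * (a : ℝ) + 1)]
      exact sum_later_div_le T (by positivity) (fun _ _ => le_rfl) fun _ => by positivity
    have k2 : |∑ a ∈ Finset.range T, (laterInBlock m a * (meanWeight m a ω / (2 * a + 1)) -
        laterInBlock m a / (2 * a + 1) * meanWeightCentre m a)| ≤
        ∑ a ∈ Finset.range T, laterInBlock m a / (2 * a + 1) *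
        |meanWeight m a ω - meanWeightCentre m a| := by
      refine (Finset.abs_sum_le_sum_abs _ _).trans (Finset.sum_le_sum fun a _ => ?_)
      rw [← abs_of_nonneg (div_nonneg (laterInBlock_nonneg hm a)
        (by positivity : (0 : ℝ) ≤ 2 * a + 1)), ← abs_mul,
        abs_of_nonneg (div_nonneg (laterInBlock_nonneg hm a)
        (by positivity : (0 : ℝ) ≤ 2 * a + 1))]
      refine le_of_eq (congrArg _ ?_)
      ring
    have k3 := abs_sum_centre_sub_le hm T
    rw [← scale] at k3
    rw [Finset.sum_sub_distrib] at k2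
    rw [Finset.sum_sub_distrib, Finset.sum_sub_distrib]
    have k4 := abs_le.mp (le_refl |∑ t ∈ Finset.range T, newPairs m t ω -
      ∑ t ∈ Finset.range T, stubMean m t (newPairs m t) ω|)
    have k5 := abs_le.mp (le_refl |∑ a ∈ Finset.range T, laterInBlock m a * targetShare m a ω -
      ∑ a ∈ Finset.range T, laterInBlock m a * (meanWeight m a ω / (2 * a + 1))|)
    have k1 := abs_le.mp k1
    have k2 := abs_le.mp k2
    have k3 := abs_le.mp k3
    rw [abs_le]
    constructor <;> linarith
  refine (histMean_mono key).trans ?_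
  rw [histMean_add, histMean_add, histMean_add, histMean_const]
  have g1 := h₁ n
  have g2 := h₂ T
  have g3 := h₃ T
  rw [← hT] at g1
  have g4 : (C₁ + C₂ + m * (2 * m) + 20 * m ^ 4) * scale T ≤
      (C₁ + C₂ + m * (2 * m) + 20 * m ^ 4) * (scale T * √(scale T)) := by gcongr
  linarith

end

/-! ### Expectations with respect to the law of the target map -/

theorem pmf_sum_toReal {α : Type*} [Fintype α] (p : PMF α) : ∑ a, (p a).toReal = 1 := by
  have h := p.tsum_coe
  rw [tsum_fintype] at h
  rw [← ENNReal.toReal_sum fun a _ => p.apply_ne_top a, h, ENNReal.toReal_one]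

theorem sum_bind_toReal {α β : Type*} [Fintype α] [Fintype β] (p : PMF α) (f : α → PMF β)
    (F : β → ℝ) : ∑ b, (p.bind f b).toReal * F b =
      ∑ a, (p a).toReal * ∑ b, (f a b).toReal * F b := by
  have h : ∀ b, (p.bind f b).toReal = ∑ a, (p a).toReal * (f a b).toReal := by
    intro b
    rw [PMF.bind_apply, tsum_fintype, ENNReal.toReal_sum fun a _ =>
      ENNReal.mul_ne_top (p.apply_ne_top a) ((f a).apply_ne_top b)]
    simp only [ENNReal.toReal_mul]
  simp only [h, Finset.sum_mul, Finset.mul_sum]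
  rw [Finset.sum_comm]
  simp only [mul_assoc]

theorem sum_pure_toReal {α : Type*} [Fintype α] (a : α) (F : α → ℝ) :
    ∑ b, (PMF.pure a b).toReal * F b = F a := by
  classical
  rw [Finset.sum_eq_single a]
  · simp
  · intro b _ hb; simp [PMF.pure_apply, hb]
  · simp

theorem sum_map_toReal {α β : Type*} [Fintype α] [Fintype β] (p : PMF α) (f : α → β)
    (F : β → ℝ) : ∑ b, (p.map f b).toReal * F b = ∑ a, (p a).toReal * F (f a) := by
  rw [PMF.map, sum_bind_toReal]
  simp only [Function.comp_apply, sum_pure_toReal]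

/-! ### Degree-proportional choice as a uniform choice of stubs -/

theorem degree_targetGraph {t : ℕ} (c : Fin t → Fin t) (s : Fin t) :
    degree (targetGraph c) s =
      ∑ e, ((if e = s then 1 else 0) + if c e = s then 1 else 0) := by
  have h1 : ∀ e, (targetGraph c).IsLoopAt e s ↔ e = s ∧ c e = s := by
    intro e
    change s(s, s) = s(e, c e) ↔ _
    rw [Sym2.eq_iff]; grind
  have h2 : ∀ e, (targetGraph c).IsNonloopAt e s ↔ e ≠ c e ∧ (e = s ∨ c e = s) := by
    intro e
    change (∃ y, y ≠ s ∧ s(s, y) = s(e, c e)) ↔ _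
    simp only [Sym2.eq_iff]
    constructor
    · rintro ⟨y, hy, ⟨h, h'⟩ | ⟨h, h'⟩⟩ <;> grind
    · rintro ⟨h, h' | h'⟩
      · exact ⟨c e, by grind, by grind⟩
      · exact ⟨e, by grind, by grind⟩
  unfold degree
  simp only [h1, h2]
  classical
  rw [Set.ncard_eq_toFinset_card', Set.ncard_eq_toFinset_card', Set.toFinset_ofPred,
    Set.toFinset_ofPred, Finset.card_filter, Finset.card_filter, Finset.mul_sum,
    ← Finset.sum_add_distrib]
  refine Finset.sum_congr rfl fun e _ => ?_
  grind

theorem sum_targetWeight_mul {t : ℕ} (c : Fin t → Fin t) (g : Fin (t + 1) → ℝ) :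
    ∑ s, (targetWeight c s).toReal * g s =
      ∑ e, (g e.castSucc + g (c e).castSucc) + g (Fin.last t) := by
  rw [Fin.sum_univ_castSucc]
  simp only [targetWeight, Fin.snoc_castSucc, Fin.snoc_last, ENNReal.toReal_natCast,
    ENNReal.toReal_one, one_mul, degree_targetGraph]
  congr 1
  push_cast
  simp only [Finset.sum_mul, add_mul, ite_mul, one_mul, zero_mul]
  rw [Finset.sum_comm]
  refine Finset.sum_congr rfl fun e _ => ?_
  rw [Finset.sum_add_distrib, Finset.sum_ite_eq, Finset.sum_ite_eq]
  simp

theorem targetWeight_ne_top {t : ℕ} (c : Fin t → Fin t) (s : Fin (t + 1)) :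
    targetWeight c s ≠ ∞ := ENNReal.ne_top_of_tsum_ne_top (tsum_targetWeight_ne_top c) s

theorem sum_newTarget_mul {t : ℕ} (c : Fin t → Fin t) (g : Fin (t + 1) → ℝ) :
    ∑ s, (newTarget c s).toReal * g s =
      (∑ e, (g e.castSucc + g (c e).castSucc) + g (Fin.last t)) / (2 * t + 1) := by
  have h : (∑' s, targetWeight c s).toReal = 2 * t + 1 := by
    rw [tsum_fintype, ENNReal.toReal_sum fun s _ => targetWeight_ne_top c s]
    have := sum_targetWeight_mul c fun _ => 1
    simp only [mul_one] at this
    rw [this]; simp; ring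
  simp only [newTarget, PMF.normalize_apply, ENNReal.toReal_mul, ENNReal.toReal_inv, h]
  rw [← sum_targetWeight_mul, Finset.sum_div]
  refine Finset.sum_congr rfl fun s _ => ?_
  ring

/-- The history of target blocks of a target map. -/
def blockHistory (m : ℕ) {t : ℕ} (c : Fin t → Fin t) (a : ℕ) : ℕ :=
  if h : a < t then (c ⟨a, h⟩ : ℕ) / m else 0

section
variable {m : ℕ}

theorem blockHistory_snoc {t : ℕ} (c : Fin t → Fin t) (s : Fin (t + 1)) :
    blockHistory m (Fin.snoc (α := fun _ => Fin (t + 1)) (fun i => (c i).castSucc) s) =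
      Function.update (blockHistory m c) t ((s : ℕ) / m) := by
  ext a
  rcases lt_trichotomy a t with h | rfl | h
  · rw [Function.update_of_ne h.ne]
    have h' : a < t + 1 := by omega
    have : (⟨a, h'⟩ : Fin (t + 1)) = Fin.castSucc ⟨a, h⟩ := rfl
    simp only [blockHistory, h, h', dif_pos]
    rw [this, Fin.snoc_castSucc]; simp
  · have : (⟨a, Nat.lt_succ_self a⟩ : Fin (a + 1)) = Fin.last a := rfl
    simp only [blockHistory, Nat.lt_succ_self, dif_pos, Function.update_self]
    rw [this, Fin.snoc_last]
  · rw [Function.update_of_ne h.ne']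
    simp [blockHistory, show ¬ a < t by omega, show ¬ a < t + 1 by omega]

theorem sum_map_stubs (ω : ℕ → ℕ) (t : ℕ) (g : ℕ → ℝ) : ((stubs m ω t).map g).sum =
    ∑ a ∈ Finset.range t, (g (a / m) + g (ω a)) + g (t / m) := by
  induction t with
  | zero => simp [stubs]
  | succ t ih => simp [stubs, ih, Finset.sum_range_succ]; ring

theorem sum_targets_mul (t : ℕ) (F : (ℕ → ℕ) → ℝ) :
    ∑ c, (targets t c).toReal * F (blockHistory m c) = histMean m t F := by
  induction t generalizing F with
  | zero =>
    rw [targets, sum_pure_toReal]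
    -- `blockHistory` takes the default value `0` beyond the edges present, which matches the zero
    -- history where `histMean` starts.
    change _ = F 0
    congr 1
  | succ t ih =>
    rw [targets, sum_bind_toReal, histMean_succ, ← ih]
    refine Finset.sum_congr rfl fun c _ => ?_
    congr 1
    rw [sum_map_toReal]
    simp only [blockHistory_snoc]
    rw [sum_newTarget_mul c fun s => F (Function.update (blockHistory m c) t ((s : ℕ) / m)),
      stubMean_apply, sum_map_stubs, Finset.sum_range]
    simp [blockHistory]

theorem le_of_mem_support_targets {t : ℕ} {c : Fin t → Fin t} (h : c ∈ (targets t).support)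
    (i : Fin t) : c i ≤ i := by
  induction t with
  | zero => exact i.elim0
  | succ t ih =>
    rw [targets, PMF.mem_support_bind_iff] at h
    obtain ⟨c', hc', h⟩ := h
    rw [PMF.mem_support_map_iff] at h
    obtain ⟨s, -, rfl⟩ := h
    induction i using Fin.lastCases with
    | last => exact Fin.le_last _
    | cast i => rw [Fin.snoc_castSucc]; exact ih hc' i

/-- Markov's inequality for the complement of `A`. -/
theorem ofReal_one_sub_le_toOuterMeasure {α : Type*} [Fintype α] (p : PMF α) {X : α → ℝ}
    (hX : ∀ a, 0 ≤ X a) {δ : ℝ} (hδ : 0 < δ) {A : Set α}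
    (hA : ∀ a ∈ p.support, X a ≤ δ → a ∈ A) :
    ENNReal.ofReal (1 - (∑ a, (p a).toReal * X a) / δ) ≤ p.toOuterMeasure A := by
  classical
  have htop : ∀ a, A.indicator p a ≠ ∞ := fun a =>
    ne_top_of_le_ne_top (p.apply_ne_top a) (Set.indicator_le_self' (fun _ _ => zero_le) a)
  rw [PMF.toOuterMeasure_apply_fintype,
    ENNReal.ofReal_le_iff_le_toReal (ENNReal.sum_ne_top.mpr fun a _ => htop a),
    ENNReal.toReal_sum fun a _ => htop a, ← pmf_sum_toReal p, Finset.sum_div,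
    ← Finset.sum_sub_distrib]
  refine Finset.sum_le_sum fun a _ => ?_
  have h0 : 0 ≤ (p a).toReal := ENNReal.toReal_nonneg
  by_cases ha : a ∈ A
  · rw [Set.indicator_of_mem ha]
    have : 0 ≤ (p a).toReal * X a / δ := div_nonneg (mul_nonneg h0 (hX a)) hδ.le
    linarith
  · rw [Set.indicator_of_notMem ha, ENNReal.toReal_zero]
    by_cases hs : p a = 0
    · simp [hs]
    · have h1 : δ < X a := lt_of_not_ge fun h => ha (hA a ((PMF.mem_support_iff p a).mpr hs) h)
      have h2 : (p a).toReal ≤ (p a).toReal * X a / δ := by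
        rw [le_div_iff₀ hδ]; gcongr
      linarith

/-! ### Parallel edges -/

theorem Parallel.symm {α β : Type*} {G : Graph α β} {e f : β} (h : Parallel G e f) :
    Parallel G f e := by
  obtain ⟨h1, x, y, h2, h3, h4⟩ := h
  exact ⟨h1.symm, x, y, h2, h4, h3⟩

theorem Parallel.trans {α β : Type*} {G : Graph α β} {e f g : β} (h : Parallel G e f)
    (h' : Parallel G f g) (hne : e ≠ g) : Parallel G e g := by
  obtain ⟨-, x, y, h2, h3, h4⟩ := h
  obtain ⟨-, x', y', -, h3', h4'⟩ := h'
  refine ⟨hne, x, y, h2, h3, ?_⟩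
  rcases h4.eq_and_eq_or_eq_and_eq h3' with ⟨rfl, rfl⟩ | ⟨rfl, rfl⟩
  · exact h4'
  · exact h4'.symm

theorem Parallel.parallelClass_eq {α β : Type*} {G : Graph α β} {e f : β} (h : Parallel G e f) :
    parallelClass G e = parallelClass G f := by
  have key : ∀ {e f}, Parallel G e f → parallelClass G e ⊆ parallelClass G f := by
    rintro e f h g (rfl | hg)
    · exact Or.inr h.symm
    · by_cases hgf : g = f
      · exact Or.inl hgf
      · exact Or.inr (h.symm.trans hg (Ne.symm hgf))
  exact Set.Subset.antisymm (key h) (key h.symm)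

theorem Parallel.left_mem {α β : Type*} {G : Graph α β} {e f : β} (h : Parallel G e f) :
    e ∈ G.edgeSet := by
  obtain ⟨-, x, y, -, h3, -⟩ := h
  exact h3.edge_mem

/-- Each parallel class is represented by its smallest edge, so the lost edges are those with a
smaller parallel edge. -/
theorem identificationReduction_eq {α β : Type*} [LinearOrder β] [Finite β] (G : Graph α β) :
    identificationReduction G = {f | ∃ e, e < f ∧ Parallel G e f}.ncard := by
  set D : Set β := {f | ∃ e, e < f ∧ Parallel G e f} with hD
  have hsub : D ⊆ G.edgeSet := fun f ⟨e, _, h⟩ => h.symm.left_mem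
  have himg : parallelClass G '' G.edgeSet = parallelClass G '' (G.edgeSet \ D) := by
    refine Set.Subset.antisymm ?_ (Set.image_mono Set.sdiff_subset)
    rintro _ ⟨e, he, rfl⟩
    induction e using WellFoundedLT.induction with
    | ind e ih =>
      by_cases h : e ∈ D
      · obtain ⟨a, ha, hp⟩ := h
        rw [← hp.parallelClass_eq]
        exact ih a ha hp.left_mem
      · exact ⟨e, ⟨he, h⟩, rfl⟩
  have hinj : Set.InjOn (parallelClass G) (G.edgeSet \ D) := by
    intro a ha b hb hab
    have h : a ∈ parallelClass G b := hab ▸ Or.inl rfl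
    rcases h with h | h
    · exact h
    · rcases lt_or_gt_of_ne h.1 with hlt | hlt
      · exact absurd ⟨b, hlt, h⟩ ha.2
      · exact absurd ⟨a, hlt, h.symm⟩ hb.2
  rw [identificationReduction, himg, hinj.ncard_image,
    Set.cast_ncard_sdiff hsub (Set.toFinite _)]
  ring

theorem numParallelPairs_eq_sum {α β : Type*} [LinearOrder β] [Fintype β] (G : Graph α β) :
    numParallelPairs G = ∑ f, {e | e < f ∧ Parallel G e f}.ncard := by
  classical
  unfold numParallelPairs
  simp only [Set.ncard_eq_toFinset_card', Set.toFinset_ofPred, Finset.card_filter]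
  rw [Fintype.sum_prod_type_right]

theorem identificationReduction_le {α β : Type*} [LinearOrder β] [Fintype β] (G : Graph α β) :
    identificationReduction G ≤ numParallelPairs G := by
  classical
  rw [identificationReduction_eq, numParallelPairs_eq_sum]
  rw [Set.ncard_eq_toFinset_card', Set.toFinset_ofPred, Finset.card_filter]
  norm_cast
  refine Finset.sum_le_sum fun f _ => ?_
  split_ifs with h
  · obtain ⟨e, he⟩ := h
    exact (Set.ncard_pos (Set.toFinite _)).mpr ⟨e, he⟩
  · exact Nat.zero_le _

/-- Counting pairs by their larger edge, each lost edge accounts for at most `k` of them and a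
surviving edge for none. -/
theorem numParallelPairs_le {α β : Type*} [LinearOrder β] [Fintype β] (G : Graph α β) {k : ℕ}
    (hk : ∀ f, {e | e < f ∧ Parallel G e f}.ncard ≤ k) :
    numParallelPairs G ≤ k * identificationReduction G := by
  classical
  rw [identificationReduction_eq, numParallelPairs_eq_sum]
  rw [Set.ncard_eq_toFinset_card', Set.toFinset_ofPred, Finset.card_filter]
  norm_cast
  rw [Finset.mul_sum]
  refine Finset.sum_le_sum fun f _ => ?_
  split_ifs with h
  · simpa using hk f
  · have : {e | e < f ∧ Parallel G e f} = ∅ := by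
      ext e; simpa using fun h1 h2 => h ⟨e, h1, h2⟩
    simp [this]

/-- Since targets never exceed sources, the larger of the two distinct end blocks is the block an
edge leaves. Parallel edges thus agree in source block and in target block. -/
theorem parallel_map_divNat_iff {n : ℕ} {c : Fin (n * m) → Fin (n * m)} (hc : ∀ i, c i ≤ i)
    {e f : Fin (n * m)} (hef : e < f) :
    Parallel ((targetGraph c).map Fin.divNat) e f ↔ (e : ℕ) / m = (f : ℕ) / m ∧
      blockHistory m c f = blockHistory m c e ∧ blockHistory m c e ≠ (f : ℕ) / m := by
  have hl : ∀ (e : Fin (n * m)) (x y : Fin n),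
      ((targetGraph c).map Fin.divNat).IsLink e x y ↔
        s(x, y) = s(e.divNat, (c e).divNat) := by
    intro e x y
    change (∃ u v, s(u, v) = s(e, c e) ∧ u.divNat = x ∧ v.divNat = y) ↔ _
    constructor
    · rintro ⟨u, v, h, rfl, rfl⟩
      rw [Sym2.eq_iff] at h
      rcases h with ⟨rfl, rfl⟩ | ⟨rfl, rfl⟩
      · rfl
      · exact Sym2.eq_swap
    · intro h
      rw [Sym2.eq_iff] at h
      rcases h with ⟨rfl, rfl⟩ | ⟨rfl, rfl⟩
      · exact ⟨e, c e, rfl, rfl, rfl⟩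
      · exact ⟨c e, e, Sym2.eq_swap, rfl, rfl⟩
  have hv : ∀ i : Fin (n * m), blockHistory m c i = ((c i).divNat : ℕ) := by
    intro i; simp [blockHistory]
  have hd : ∀ i : Fin (n * m), (i : ℕ) / m = (i.divNat : ℕ) := fun i => rfl
  have h1 : (c e).divNat ≤ e.divNat := Nat.div_le_div_right (hc e)
  have h2 : (c f).divNat ≤ f.divNat := Nat.div_le_div_right (hc f)
  have h3 : e.divNat ≤ f.divNat := Nat.div_le_div_right hef.le
  rw [hv, hv, hd, hd]
  simp only [Parallel, hl, ne_eq, ← Fin.ext_iff]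
  constructor
  · rintro ⟨-, x, y, hxy, h4, h5⟩
    have h6 := h4.symm.trans h5
    rw [Sym2.eq_iff] at h6 h4
    grind
  · rintro ⟨h4, h5, h6⟩
    exact ⟨hef.ne, e.divNat, (c e).divNat, by grind, rfl, by rw [h4, h5]⟩

theorem ncard_parallel_eq {n : ℕ} {c : Fin (n * m) → Fin (n * m)}
    (hc : ∀ i, c i ≤ i) (f : Fin (n * m)) :
    ({e | e < f ∧ Parallel ((targetGraph c).map Fin.divNat) e f}.ncard : ℝ) =
      newPairs m f (blockHistory m c) := by
  classical
  have h1 : ∀ e : Fin (n * m), (e < f ∧ Parallel ((targetGraph c).map Fin.divNat) e f) ↔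
      ((e : ℕ) < f ∧ (e : ℕ) / m = (f : ℕ) / m) ∧
      (blockHistory m c f = blockHistory m c e ∧ blockHistory m c e ≠ (f : ℕ) / m) := by
    intro e
    rw [and_assoc]
    exact and_congr_right fun h => parallel_map_divNat_iff hc h
  have h2 : earlier m f = (Finset.range (n * m)).filter
      fun a => a < (f : ℕ) ∧ a / m = (f : ℕ) / m := by
    ext a
    have := f.2
    simp only [earlier, Finset.mem_filter, Finset.mem_range]
    omega
  simp only [h1]
  rw [Set.ncard_eq_toFinset_card', Set.toFinset_ofPred, Finset.card_filter, newPairs, h2,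
    Finset.sum_filter, Finset.sum_range]
  push_cast
  refine Finset.sum_congr rfl fun e _ => ?_
  rw [ite_and]

theorem numParallelPairs_map_eq {n : ℕ} {c : Fin (n * m) → Fin (n * m)} (hc : ∀ i, c i ≤ i) :
    (numParallelPairs ((targetGraph c).map Fin.divNat) : ℝ) =
      ∑ t ∈ Finset.range (n * m), newPairs m t (blockHistory m c) := by
  rw [numParallelPairs_eq_sum, Finset.sum_range]
  push_cast
  exact Finset.sum_congr rfl fun f _ => ncard_parallel_eq hc f

end

/-! ### Asymptotics -/

theorem half_log_le_oddHarmonic (T : ℕ) : Real.log (T + 1) / 2 ≤ oddHarmonic T := by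
  have h1 := log_add_one_le_harmonic T
  have h2 : (harmonic T : ℝ) / 2 ≤ oddHarmonic T := by
    rw [harmonic, oddHarmonic]
    push_cast
    rw [Finset.sum_div]
    refine Finset.sum_le_sum fun a _ => ?_
    rw [inv_eq_one_div, div_div]
    gcongr
    linarith
  push_cast at h1
  linarith

theorem oddHarmonic_le_half_log (T : ℕ) : oddHarmonic T ≤ 3 / 2 + Real.log T / 2 := by
  have h1 := harmonic_le_one_add_log T
  have h2 : oddHarmonic (T + 1) ≤ 1 + (harmonic T : ℝ) / 2 := by
    rw [harmonic, oddHarmonic, Finset.sum_range_succ']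
    push_cast
    rw [Finset.sum_div, add_comm]
    refine add_le_add (by simp) (Finset.sum_le_sum fun a _ => ?_)
    rw [inv_eq_one_div, div_div]
    gcongr
    linarith
  have h3 := oddHarmonic_mono (Nat.le_succ T)
  linarith

theorem exists_histMean_abs_sub_log_sq_le {m : ℕ} (hm : 1 ≤ m) : ∃ C : ℝ, ∀ᶠ n : ℕ in atTop,
    histMean m (n * m) (fun ω => |∑ t ∈ Finset.range (n * m), newPairs m t ω -
      (m ^ 2 - 1) / 16 * Real.log n ^ 2|) ≤ C * (Real.log n * √(Real.log n)) := by
  obtain ⟨C, hC, h⟩ := exists_histMean_abs_sum_newPairs_sub_le hm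
  have hm' : (1 : ℝ) ≤ m := by exact_mod_cast hm
  -- `K` bounds `2H - log n`: the `3` comes from the upper bound for the odd harmonic sum, and `log
  -- m` from the range `n * m`.
  set K := 3 + Real.log m with hK
  have hK0 : 3 ≤ K := by linarith [Real.log_nonneg hm']
  refine ⟨C * 4 + m ^ 2 * (3 * K), ?_⟩
  have hlog : Tendsto (fun n : ℕ => Real.log n) atTop atTop :=
    Real.tendsto_log_atTop.comp tendsto_natCast_atTop_atTop
  filter_upwards [hlog.eventually_ge_atTop (1 + K), eventually_ge_atTop 1] with n hn hn1
  set L := Real.log n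
  set H := oddHarmonic (n * m) with hH
  have hn0 : (1 : ℝ) ≤ n := by exact_mod_cast hn1
  have h1 : L ≤ 2 * H := by
    have := half_log_le_oddHarmonic (n * m)
    have h2 : L ≤ Real.log ((n * m : ℕ) + 1) := by
      refine Real.log_le_log (by linarith) ?_
      push_cast; nlinarith
    linarith
  have h2 : 2 * H ≤ L + K := by
    have := oddHarmonic_le_half_log (n * m)
    have h3 : Real.log ((n * m : ℕ) : ℝ) = L + Real.log m := by
      push_cast
      exact Real.log_mul (by positivity) (by positivity)
    linarith
  have hL1 : 1 ≤ √L := Real.one_le_sqrt.mpr (by linarith)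
  have hB : scale (n * m) ≤ 2 * L := by rw [scale]; linarith
  have hBs : √(scale (n * m)) ≤ 2 * √L := by
    refine Real.sqrt_le_iff.mpr ⟨by positivity, ?_⟩
    rw [mul_pow, Real.sq_sqrt (by linarith)]; linarith
  have h3 : scale (n * m) * √(scale (n * m)) ≤ 4 * (L * √L) := by
    calc _ ≤ (2 * L) * (2 * √L) := by
          have := one_le_scale (n * m)
          gcongr
      _ = _ := by ring
  have h4 : |(m ^ 2 - 1) / 4 * H ^ 2 - (m ^ 2 - 1) / 16 * L ^ 2| ≤
      (m : ℝ) ^ 2 * (3 * K * (L * √L)) := by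
    have e : ((m : ℝ) ^ 2 - 1) / 4 * H ^ 2 - (m ^ 2 - 1) / 16 * L ^ 2 =
      (m ^ 2 - 1) / 16 * ((2 * H - L) * (2 * H + L)) := by ring
    have h5 : (2 * H - L) * (2 * H + L) ≤ K * (3 * (L * √L)) := by
      have : 2 * H + L ≤ 3 * (L * √L) := by nlinarith
      gcongr
      · linarith
      · linarith
    have h6 : 0 ≤ (2 * H - L) * (2 * H + L) := mul_nonneg (by linarith) (by linarith)
    have h7 : 0 ≤ ((m : ℝ) ^ 2 - 1) / 16 := by nlinarith
    rw [e, abs_of_nonneg (mul_nonneg h7 h6)]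
    calc _ ≤ (m : ℝ) ^ 2 * (K * (3 * (L * √L))) := by
          gcongr; linarith [sq_nonneg (m : ℝ)]
      _ = _ := by ring
  calc _ ≤ histMean m (n * m) (fun ω => |∑ t ∈ Finset.range (n * m), newPairs m t ω -
        (m ^ 2 - 1) / 4 * H ^ 2| + (m : ℝ) ^ 2 * (3 * K * (L * √L))) :=
        histMean_mono fun ω _ => (abs_sub_le _ _ _).trans (add_le_add le_rfl h4)
    _ ≤ C * (4 * (L * √L)) + (m : ℝ) ^ 2 * (3 * K * (L * √L)) := by
        rw [histMean_add, histMean_const]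
        gcongr
        exact (h n).trans (by gcongr)
    _ = _ := by ring

/-! ### High-probability statements for `Gₘ` -/

theorem Gₘ_toOuterMeasure (m n : ℕ) (A : Set (Graph (Fin n) (Fin (n * m)))) :
    (Gₘ m n).toOuterMeasure A =
      (targets (n * m)).toOuterMeasure {c | (targetGraph c).map Fin.divNat ∈ A} := by
  rw [Gₘ, G₁, PMF.toOuterMeasure_map_apply, PMF.toOuterMeasure_map_apply]
  rfl

theorem whp_of_pairs {m : ℕ} (hm : 2 ≤ m) {ε : ℝ} (hε : 0 < ε)
    {A : ∀ n, Set (Graph (Fin n) (Fin (n * m)))}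
    (hA : ∀ n, ∀ c : Fin (n * m) → Fin (n * m), (∀ i, c i ≤ i) →
      |(numParallelPairs ((targetGraph c).map Fin.divNat) : ℝ) -
        ((m : ℝ) ^ 2 - 1) / 16 * Real.log n ^ 2| ≤
        ε * (((m : ℝ) ^ 2 - 1) / 16 * Real.log n ^ 2) → (targetGraph c).map Fin.divNat ∈ A n) :
    Whp (fun n => Gₘ m n) A := by
  obtain ⟨C, hC⟩ := exists_histMean_abs_sub_log_sq_le (m := m) (by omega)
  have hlog : Tendsto (fun n : ℕ => Real.log n) atTop atTop :=
    Real.tendsto_log_atTop.comp tendsto_natCast_atTop_atTop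
  set μ : ℝ := ((m : ℝ) ^ 2 - 1) / 16 with hμ
  have hμ0 : 0 < μ := by
    have : (2 : ℝ) ≤ m := by exact_mod_cast hm
    rw [hμ]; nlinarith
  -- Mean error `C L √L` over the allowed deviation `ε μ L²` is `C / (ε μ √L)`, with `L = log n`.
  have hlim : Tendsto (fun n : ℕ => ENNReal.ofReal (1 - C / (ε * μ) * (√(Real.log n))⁻¹))
      atTop (𝓝 1) := by
    have h1 : Tendsto (fun n : ℕ => (√(Real.log n))⁻¹) atTop (𝓝 0) :=
      (Real.tendsto_sqrt_atTop.comp hlog).inv_tendsto_atTop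
    have h2 := (h1.const_mul (C / (ε * μ))).const_sub 1
    rw [mul_zero, sub_zero] at h2
    simpa using ENNReal.tendsto_ofReal h2
  refine tendsto_of_tendsto_of_tendsto_of_le_of_le' hlim tendsto_const_nhds ?_
    (Eventually.of_forall fun n => ?_)
  · filter_upwards [hC, hlog.eventually_ge_atTop 1] with n hn hL
    rw [Gₘ_toOuterMeasure]
    set L := Real.log n
    have hs : 0 < √L := Real.sqrt_pos.mpr (by linarith)
    refine le_trans (ENNReal.ofReal_le_ofReal ?_) (ofReal_one_sub_le_toOuterMeasure
      (targets (n * m)) (X := fun c => |∑ t ∈ Finset.range (n * m),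
        newPairs m t (blockHistory m c) - μ * L ^ 2|) (fun _ => abs_nonneg _)
      (δ := ε * (μ * L ^ 2)) (by positivity) fun c hc hX => ?_)
    · rw [sum_targets_mul (m := m) (n * m) fun ω =>
        |∑ t ∈ Finset.range (n * m), newPairs m t ω - μ * L ^ 2|]
      refine sub_le_sub_left ?_ 1
      rw [div_le_iff₀ (by positivity)]
      refine hn.trans_eq ?_
      have : L * √L = L ^ 2 / √L := by
        rw [eq_div_iff hs.ne', mul_assoc, Real.mul_self_sqrt (by linarith), sq]
      rw [this]
      field_simp
    · have hc' := le_of_mem_support_targets hc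
      refine hA n c hc' ?_
      rw [numParallelPairs_map_eq hc']
      exact hX
  · calc _ ≤ (Gₘ m n).toOuterMeasure Set.univ := MeasureTheory.measure_mono (Set.subset_univ _)
      _ = 1 := (PMF.toOuterMeasure_apply_eq_one_iff _ _).mpr (Set.subset_univ _)

theorem whp_of_forall {m : ℕ} {A : ∀ n, Set (Graph (Fin n) (Fin (n * m)))}
    (hA : ∀ n, ∀ c : Fin (n * m) → Fin (n * m), (∀ i, c i ≤ i) →
      (targetGraph c).map Fin.divNat ∈ A n) : Whp (fun n => Gₘ m n) A := by
  have : ∀ n, (Gₘ m n).toOuterMeasure (A n) = 1 := fun n => by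
    rw [Gₘ_toOuterMeasure, PMF.toOuterMeasure_apply_eq_one_iff]
    exact fun c hc => hA n c (le_of_mem_support_targets hc)
  simp only [Whp, this]
  exact tendsto_const_nhds

theorem newPairs_one (t : ℕ) (ω : ℕ → ℕ) : newPairs 1 t ω = 0 := by
  refine Finset.sum_eq_zero fun a ha => ?_
  simp only [earlier, Finset.mem_filter, Finset.mem_range, Nat.div_one] at ha
  omega

end PrefAttach

theorem mainTheorem8 (m : ℕ) (hm : 1 ≤ m) :
    (∀ ε : ℝ, 0 < ε →
      PrefAttach.Whp (fun n => PrefAttach.Gₘ m n) (fun n =>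
        {G | |(PrefAttach.numParallelPairs G : ℝ) - ((m : ℝ) ^ 2 - 1) / 16 * Real.log n ^ 2| ≤
          ε * (((m : ℝ) ^ 2 - 1) / 16 * Real.log n ^ 2)})) ∧
    (2 ≤ m →
      ∃ c C : ℝ, 0 < c ∧ 0 < C ∧
        PrefAttach.Whp (fun n => PrefAttach.Gₘ m n) (fun n =>
          {G | c * Real.log n ^ 2 ≤ PrefAttach.identificationReduction G ∧
            PrefAttach.identificationReduction G ≤ C * Real.log n ^ 2})) := by
  open PrefAttach in
  constructor
  · intro ε hε
    -- For `m = 1` the constant `m² - 1` vanishes and Markov's inequality gives nothing, but then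
    -- there are no parallel pairs at all.
    rcases hm.eq_or_lt with rfl | hm2
    · refine whp_of_forall fun n c hc => ?_
      rw [Set.mem_ofPred_eq, numParallelPairs_map_eq hc]
      simp [newPairs_one]
    · exact whp_of_pairs hm2 hε fun n c _ h => h
  · intro hm2
    have hm' : (2 : ℝ) ≤ m := by exact_mod_cast hm2
    have hμ : 0 < ((m : ℝ) ^ 2 - 1) / 16 := by nlinarith
    -- With `ε = 1/2` the pairs number between `1/2` and `3/2` of the centre; the lower constant is
    -- further divided by `m`, the maximal number of pairs per lost edge.
    refine ⟨((m : ℝ) ^ 2 - 1) / 16 / (2 * m), 3 / 2 * (((m : ℝ) ^ 2 - 1) / 16),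
      by positivity, by positivity, whp_of_pairs hm2 (ε := 1 / 2) (by norm_num) fun n c hc h => ?_⟩
    have h1 := identificationReduction_le ((targetGraph c).map (Fin.divNat (m := n) (n := m)))
    have h2 := numParallelPairs_le ((targetGraph c).map (Fin.divNat (m := n) (n := m))) (k := m)
      fun f => by
        have := newPairs_le hm f (blockHistory m c)
        rw [← ncard_parallel_eq hc] at this
        exact_mod_cast this
    obtain ⟨h3, h4⟩ := abs_le.mp h
    refine ⟨?_, by linarith⟩
    rw [div_mul_eq_mul_div, div_le_iff₀ (by positivity)]
    linarith
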